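/- **Spinors.** For $p\ge 0$ and $\zeta,\alpha\in\mathbb Z_2^p$ let $S^\zeta_\alpha=\sum_{x\in\mathbb Z_2^p}(-1)^{\zeta\cdot x}\,|x\rangle\langle x+\alpha|$ be the spinor (Pauli string) with label $(\zeta,\alpha)$; $i(-i)^{\zeta\cdot\alpha}S^\zeta_\alpha$ (integer exponent $\sum_k\zeta_k\alpha_k$) is skew-Hermitian. For a set $T$ of labels, $\langle T\rangle$ is the real span of these skew-Hermitian matrices with label in $T$. Addition of labels is called bi-addition, and a bi-subalgebra is a subgroup of the group $\mathbb Z_2^p\times\mathbb Z_2^p$ of labels. A Cartan subalgebra $\mathfrak C$ of $su(2^p)$ is here a bi-subalgebra that consists exactly of the labels whose spinors commute with all spinors of $\mathfrak C$. A maximal bi-subalgebra of a bi-subalgebra $\mathcal M$ is a bi-subalgebra $\mathcal B\subseteq \mathcal M$ such that $v+w\in \mathcal B$ for all $v,w\in \mathcal M\setminus \mathcal B$ (so $\mathcal B=\mathcal M$ is allowed); an $r$-th maximal bi-subalgebra of $\mathfrak C$ is obtained from $\mathfrak C$ by passing $r$ times to a proper maximal bi-subalgebra. The set $\mathcal G(\mathfrak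 C)$ of all maximal bi-subalgebras of $\mathfrak C$ is an abelian group under $\mathcal B\sqcap \mathcal B'=(\mathcal B\cap \mathcal B')\cup(\mathcal B^c\cap \mathcal B'^c)$ (complements in $\mathfrak C$), with identity $\mathfrak C$. **Quotient-algebra partitions.** Let $\mathcal B^{[r]}$ be an $r$-th maximal bi-subalgebra of a Cartan subalgebra $\mathfrak C$. A quotient-algebra partition of rank $r$ over $su(2^p)$ given by $\mathcal B^{[r]}$ is a family of sets $W^\epsilon(\mathcal B;i)$ of labels ($\epsilon\in\mathbb Z_2$, $\mathcal B\in\mathcal G(\mathfrak C)$, $i\in\mathbb Z_2^r$; some may be empty, i.e. null) such that 1. every label lies in exactly one of them; 2. $W^1(\mathfrak C;0)=\mathcal B^{[r]}$, each $W^1(\mathfrak C;i)$ is a coset of $\mathcal B^{[r]}$ in $\mathfrak C$, and each $W^0(\mathfrak C;i)$ is empty; 3. the spinors of $W^\epsilon(\mathcal B;i)$ commute with those of $\mathcal B$; 4. for $v\in W^\epsilon(\mathcal B;i)$ and $w\in W^\sigma(\mathcal B;j)$ one has $v+w\in W^1(\mathfrak C;i+j)$, and $v+w\in\mathcal B$ if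 and only if $\epsilon=\sigma$; 5. (closure) $[\langle W^\epsilon(\mathcal B;i)\rangle,\langle W^\sigma(\mathcal B';j)\rangle]\subseteq\langle W^{\epsilon+\sigma}(\mathcal B\sqcap\mathcal B';i+j)\rangle$. The index group $\mathbb Z_2\times\mathcal G(\mathfrak C)\times\mathbb Z_2^r$, with $(\epsilon,\mathcal B,i)+(\sigma,\mathcal B',j)=(\epsilon+\sigma,\mathcal B\sqcap\mathcal B',i+j)$, is the group of the partition under the tri-addition. **Passing to $su(N)$.** Let $2^{p-1}<N\le 2^p$ and let $U\in U(N)$ (a choice of orthonormal basis of $\mathbb C^N$). Embed $\mathbb C^N$ in $\mathbb C^{2^p}$ as the span of the first $N$ computational basis vectors. For a set $T$ of labels, let $\langle T\rangle_{N,U}$ be the subspace of all $X\in su(N)$ for which $U^\dagger XU$, placed in the upper left $N\times N$ block of a $2^p\times 2^p$ matrix that is zero elsewhere, lies in $\langle T\rangle$ (the removing process). A quotient-algebra partition over $su(N)$ (relative to $U$) is a quotient-algebra partition over $su(2^p)$ whose members still partition $su(N)$ after removal, i.e. $su(N)$ is the direct sum of the subspaces $\langle W^\epsilon(\mathcal B;i)\rangle_{N,U}$.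 **Theorem.** Let $2^{p-1}<N\le2^p$, $U\in U(N)$, and let $\mathfrak t,\mathfrak p$ be real subspaces of $su(N)$ with $\mathfrak p\ne0$. The following are equivalent. (a) $\mathfrak t$ and $\mathfrak p$ are generated by complementary sets of spinors, i.e. $\mathfrak t=\langle T\rangle_{N,U}$ and $\mathfrak p=\langle T^c\rangle_{N,U}$ for some set $T$ of labels, and $su(N)=\mathfrak t\oplus\mathfrak p$ is a Cartan decomposition: $[\mathfrak t,\mathfrak t]\subseteq\mathfrak t$, $[\mathfrak t,\mathfrak p]\subseteq\mathfrak p$, $[\mathfrak p,\mathfrak p]\subseteq\mathfrak t$ and $\mathrm{Tr}(\mathfrak t\mathfrak p)=0$. (b) There are a rank $r$, a quotient-algebra partition $\{W^\epsilon(\mathcal B;i)\}$ of rank $r$ over $su(N)$ relative to $U$, and a proper maximal subgroup $H$ of its group under the tri-addition, such that $\mathfrak t$ is the sum of the members $\langle W^\epsilon(\mathcal B;i)\rangle_{N,U}$ with index in $H$ and $\mathfrak p$ is the sum of the members with index in the other coset of $H$. -/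

import Mathlib

open scoped Matrix

noncomputable section

attribute [local instance] LieRing.ofAssociativeRing

/-- Binary strings of length `p`, the elements of `Z_2^p`. -/
abbrev BitStr (p : ℕ) : Type := Fin p → ZMod 2

/-- Labels `(ζ, α)` of the spinors `S^ζ_α` on `p` qubits: the phase string `ζ` and the
binary-partitioning string `α`. Addition of labels is the bi-addition. -/
abbrev SpinorLabel (p : ℕ) : Type := BitStr p × BitStr p

/-- The spinor `S^ζ_α = ∑_x (-1)^(ζ·x) |x⟩⟨x + α|`, a tensor product of the one-qubit matrices
`S^0_0 = 1`, `S^1_0 = |0⟩⟨0| - |1⟩⟨1|`, `S^0_1 = |0⟩⟨1| + |1⟩⟨0|`, `S^1_1 = |0⟩⟨1| - |1⟩⟨0|`. -/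
def spinor {p : ℕ} (v : SpinorLabel p) : Matrix (BitStr p) (BitStr p) ℂ :=
  Matrix.of fun x y => if y = x + v.2 then (-1 : ℂ) ^ (v.1 ⬝ᵥ x).val else 0

/-- The skew-Hermitian multiple `i · (-i)^(ζ·α) S^ζ_α` of a spinor; in the exponent `ζ·α` is the
integer number of positions at which both strings carry a `1`. -/
def skewSpinor {p : ℕ} (v : SpinorLabel p) : Matrix (BitStr p) (BitStr p) ℂ :=
  (Complex.I * (-Complex.I) ^ (∑ k, (v.1 k).val * (v.2 k).val)) • spinor v

/-- The real subspace of `u(2^p)` spanned by the spinors with labels in `T`. -/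
def spinorSpan {p : ℕ} (T : Set (SpinorLabel p)) :
    Submodule ℝ (Matrix (BitStr p) (BitStr p) ℂ) :=
  Submodule.span ℝ (skewSpinor '' T)

/-- The real Lie algebra `su(N)` of traceless skew-Hermitian matrices. -/
def su (N : ℕ) : LieSubalgebra ℝ (Matrix (Fin N) (Fin N) ℂ) where
  carrier := {X | Xᴴ = -X ∧ X.trace = 0}
  add_mem' := by
    rintro X Y ⟨hX, hX'⟩ ⟨hY, hY'⟩
    refine ⟨?_, ?_⟩
    · rw [Matrix.conjTranspose_add, hX, hY]; abel
    · rw [Matrix.trace_add, hX', hY', add_zero]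
  zero_mem' := by simp
  smul_mem' := by
    rintro c X ⟨hX, hX'⟩
    refine ⟨?_, ?_⟩
    · rw [Matrix.conjTranspose_smul, hX]; simp
    · rw [Matrix.trace_smul, hX', smul_zero]
  lie_mem' := by
    rintro X Y ⟨hX, -⟩ ⟨hY, -⟩
    refine ⟨?_, ?_⟩
    · rw [Ring.lie_def, Matrix.conjTranspose_sub, Matrix.conjTranspose_mul,
        Matrix.conjTranspose_mul, hX, hY]
      simp
    · rw [Ring.lie_def, Matrix.trace_sub, Matrix.trace_mul_comm X Y, sub_self]

/-- A Cartan decomposition `su(N) = t ⊕ 𝔭` (the decomposition condition). -/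
structure IsCartanDecomposition {N : ℕ} (t 𝔭 : Submodule ℝ (su N)) : Prop where
  isCompl : IsCompl t 𝔭
  lie_t_t : ∀ X ∈ t, ∀ Y ∈ t, ⁅X, Y⁆ ∈ t
  lie_t_p : ∀ X ∈ t, ∀ Y ∈ 𝔭, ⁅X, Y⁆ ∈ 𝔭
  lie_p_p : ∀ X ∈ 𝔭, ∀ Y ∈ 𝔭, ⁅X, Y⁆ ∈ t
  trace_mul : ∀ X ∈ t, ∀ Y ∈ 𝔭, ((X : Matrix (Fin N) (Fin N) ℂ) * Y).trace = 0

/-! ### Passing from `su(2^p)` to `su(N)` -/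

/-- The `p`-digit binary expansion of `i`, most significant digit first. -/
def bits (p : ℕ) {N : ℕ} (i : Fin N) : BitStr p :=
  fun k => if (i : ℕ).testBit (Fin.rev k) then 1 else 0

/-- The inclusion of `ℂ^N` into `ℂ^(2^p)` on the first `N` computational basis vectors. -/
def blockIncl (p N : ℕ) : Matrix (BitStr p) (Fin N) ℂ :=
  Matrix.of fun x i => if x = bits p i then 1 else 0

/-- Write `X ∈ su(N)` in the orthonormal basis formed by the columns of `U`, and put it in the
upper left `N × N` block of a `2^p × 2^p` matrix, with zeros elsewhere. -/
def placeBlock (p : ℕ) {N : ℕ} (U : Matrix.unitaryGroup (Fin N) ℂ) :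
    su N →ₗ[ℝ] Matrix (BitStr p) (BitStr p) ℂ where
  toFun X := (blockIncl p N * (U : Matrix (Fin N) (Fin N) ℂ)ᴴ) * (X : Matrix (Fin N) (Fin N) ℂ) *
    (blockIncl p N * (U : Matrix (Fin N) (Fin N) ℂ)ᴴ)ᴴ
  map_add' X Y := by
    rw [AddMemClass.coe_add, Matrix.mul_add, Matrix.add_mul]
  map_smul' c X := by
    rw [SetLike.val_smul, Matrix.mul_smul, Matrix.smul_mul, RingHom.id_apply]

/-- The removing process: from the span of the spinors in `T`, only the matrices supported on the
first `N` basis vectors (no index `> N`) are kept, regarded as elements of `su(N)` relative to the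
orthonormal basis `U`. For `N = 2^p` nothing is removed but the multiples of the identity. -/
def removed {p N : ℕ} (U : Matrix.unitaryGroup (Fin N) ℂ) (T : Set (SpinorLabel p)) :
    Submodule ℝ (su N) :=
  (spinorSpan T).comap (placeBlock p U)

/-- `t` and `𝔭` are generated by complementary sets of spinors. -/
def IsSpinorGenerated (p : ℕ) {N : ℕ} (U : Matrix.unitaryGroup (Fin N) ℂ)
    (t 𝔭 : Submodule ℝ (su N)) : Prop :=
  ∃ T : Set (SpinorLabel p), t = removed U T ∧ 𝔭 = removed U Tᶜ

/-! ### Bi-subalgebras -/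

/-- A bi-subalgebra is a set of spinors closed under bi-addition, i.e. a subgroup of the group of
labels. This one is a Cartan subalgebra of `su(2^p)`: abelian, and maximal with this property. -/
def IsCartanBisubalgebra {p : ℕ} (C : AddSubgroup (SpinorLabel p)) : Prop :=
  ∀ v, v ∈ C ↔ ∀ w ∈ C, Commute (spinor v) (spinor w)

/-- `B` is a maximal bi-subalgebra of `M` (`B = M` is allowed). -/
def IsMaximalBisubalgebra {p : ℕ} (B M : AddSubgroup (SpinorLabel p)) : Prop :=
  B ≤ M ∧ ∀ v ∈ M, ∀ w ∈ M, v ∉ B → w ∉ B → v + w ∈ B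

/-- `B` is an `r`-th maximal bi-subalgebra of `C`: the `0`-th one is `C` itself, and an
`(r+1)`-th one is a proper maximal bi-subalgebra of an `r`-th one. -/
inductive IsRthMaximal {p : ℕ} (C : AddSubgroup (SpinorLabel p)) :
    ℕ → AddSubgroup (SpinorLabel p) → Prop
  | zero : IsRthMaximal C 0 C
  | succ {r : ℕ} {B B' : AddSubgroup (SpinorLabel p)} :
      IsRthMaximal C r B → IsMaximalBisubalgebra B' B → B' ≠ B → IsRthMaximal C (r + 1) B'

/-- The set `𝒢(C)` of all maximal bi-subalgebras of `C`, including `C`. -/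
def MaxBisub {p : ℕ} (C : AddSubgroup (SpinorLabel p)) : Type :=
  {B : AddSubgroup (SpinorLabel p) // IsMaximalBisubalgebra B C}

theorem SpinorLabel.neg_eq {p : ℕ} (v : SpinorLabel p) : -v = v := by
  ext k <;> exact ZMod.neg_eq_self_mod_two _

theorem IsMaximalBisubalgebra.add_mem_iff {p : ℕ} {B M : AddSubgroup (SpinorLabel p)}
    (h : IsMaximalBisubalgebra B M) {v w : SpinorLabel p} (hv : v ∈ M) (hw : w ∈ M) :
    v + w ∈ B ↔ (v ∈ B ↔ w ∈ B) := by
  by_cases h1 : v ∈ B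
  · simp [h1, B.add_mem_cancel_left h1]
  · by_cases h2 : w ∈ B
    · simp [h1, h2, B.add_mem_cancel_right h2]
    · simp [h1, h2, h.2 v hv w hw h1 h2]

/-- The bi-subalgebra `B ⊓ B' = (B ∩ B') ∪ (Bᶜ ∩ B'ᶜ)`, complements being taken in `C`. -/
def sqcapSubgroup {p : ℕ} {C : AddSubgroup (SpinorLabel p)} (B B' : MaxBisub C) :
    AddSubgroup (SpinorLabel p) where
  carrier := {v | v ∈ C ∧ (v ∈ B.1 ↔ v ∈ B'.1)}
  add_mem' := by
    rintro v w ⟨hv, hv'⟩ ⟨hw, hw'⟩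
    refine ⟨C.add_mem hv hw, ?_⟩
    rw [B.2.add_mem_iff hv hw, B'.2.add_mem_iff hv hw, hv', hw']
  zero_mem' := ⟨C.zero_mem, by simp⟩
  neg_mem' := by
    rintro v hv
    simpa only [SpinorLabel.neg_eq] using hv

theorem mem_sqcapSubgroup {p : ℕ} {C : AddSubgroup (SpinorLabel p)} (B B' : MaxBisub C)
    (v : SpinorLabel p) : v ∈ sqcapSubgroup B B' ↔ v ∈ C ∧ (v ∈ B.1 ↔ v ∈ B'.1) :=
  Iff.rfl

theorem MaxBisub.ext' {p : ℕ} {C : AddSubgroup (SpinorLabel p)} {B B' : MaxBisub C}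
    (h : ∀ v ∈ C, v ∈ B.1 ↔ v ∈ B'.1) : B = B' := by
  apply Subtype.ext
  ext v
  by_cases hv : v ∈ C
  · exact h v hv
  · exact ⟨fun hB => absurd (B.2.1 hB) hv, fun hB => absurd (B'.2.1 hB) hv⟩

instance {p : ℕ} (C : AddSubgroup (SpinorLabel p)) : Zero (MaxBisub C) where
  zero := ⟨C, le_rfl, fun _ hv _ _ h _ => absurd hv h⟩

instance {p : ℕ} (C : AddSubgroup (SpinorLabel p)) : Add (MaxBisub C) where
  add B B' := ⟨sqcapSubgroup B B', fun _ hv => hv.1, by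
    intro v hv w hw h1 h2
    rw [mem_sqcapSubgroup] at h1 h2 ⊢
    rw [B.2.add_mem_iff hv hw, B'.2.add_mem_iff hv hw]
    exact ⟨C.add_mem hv hw, by tauto⟩⟩

instance {p : ℕ} (C : AddSubgroup (SpinorLabel p)) : Neg (MaxBisub C) where
  neg B := B

/-- `𝒢(C)` is an abelian group under `⊓`, with identity `C`. -/
instance {p : ℕ} (C : AddSubgroup (SpinorLabel p)) : AddCommGroup (MaxBisub C) where
  nsmul := nsmulRec
  zsmul := zsmulRec
  add_assoc A B D := MaxBisub.ext' fun v hv => by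
    change (v ∈ C ∧ ((v ∈ C ∧ (v ∈ A.1 ↔ v ∈ B.1)) ↔ v ∈ D.1)) ↔
      (v ∈ C ∧ (v ∈ A.1 ↔ (v ∈ C ∧ (v ∈ B.1 ↔ v ∈ D.1))))
    tauto
  zero_add A := MaxBisub.ext' fun v hv => by
    change (v ∈ C ∧ (v ∈ C ↔ v ∈ A.1)) ↔ v ∈ A.1
    tauto
  add_zero A := MaxBisub.ext' fun v hv => by
    change (v ∈ C ∧ (v ∈ A.1 ↔ v ∈ C)) ↔ v ∈ A.1
    tauto
  neg_add_cancel A := MaxBisub.ext' fun v hv => by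
    change (v ∈ C ∧ (v ∈ A.1 ↔ v ∈ A.1)) ↔ v ∈ C
    tauto
  add_comm A B := MaxBisub.ext' fun v hv => by
    change (v ∈ C ∧ (v ∈ A.1 ↔ v ∈ B.1)) ↔ (v ∈ C ∧ (v ∈ B.1 ↔ v ∈ A.1))
    tauto

/-! ### Quotient algebra partitions -/

/-- The index group of the conditioned subspaces `W^ε(B, B^[r]; i)`, with `ε ∈ Z_2`, `B ∈ 𝒢(C)` and
`i ∈ Z_2^r`. Its addition `(ε, B, i) + (σ, B', j) = (ε + σ, B ⊓ B', i + j)` is the tri-addition. -/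
abbrev TriIndex {p : ℕ} (C : AddSubgroup (SpinorLabel p)) (r : ℕ) : Type :=
  ZMod 2 × MaxBisub C × BitStr r

/-- `W` lists the conditioned subspaces `W^ε(M, B; i)` (as sets of spinors, null ones being empty)
of a quotient algebra partition of rank `r` over `su(2^p)`, generated by the `r`-th maximal
bi-subalgebra `B` of the Cartan subalgebra `C`. -/
structure IsQuotientAlgebraPartition {p r : ℕ} (C B : AddSubgroup (SpinorLabel p))
    (W : TriIndex C r → Set (SpinorLabel p)) : Prop where
  isCartan : IsCartanBisubalgebra C
  isRthMaximal : IsRthMaximal C r B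
  /-- The members partition the set of all spinors. -/
  partition : ∀ v, ∃! g, v ∈ W g
  /-- Degrade members: `W^1(C, B; 0) = B`. -/
  degrade_one_zero : W (1, 0, 0) = B
  /-- Degrade members: every `W^1(C, B; i)` is a coset of `B` in `C`. -/
  degrade_one : ∀ i, ∃ c ∈ C, W (1, 0, i) = {v | v + c ∈ B}
  /-- Degrade members: `W^0(C, B; i) = {0}` is null. -/
  degrade_zero : ∀ i, W (0, 0, i) = ∅
  /-- The commutator rule `[W^ε(M, B; i), M] = 0`. -/
  commutator_rule : ∀ (ε : ZMod 2) (M : MaxBisub C) (i : BitStr r),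
    ∀ v ∈ W (ε, M, i), ∀ w ∈ M.1, Commute (spinor v) (spinor w)
  /-- The coset rule of partition. -/
  coset_rule : ∀ (ε σ : ZMod 2) (M : MaxBisub C) (i j : BitStr r),
    ∀ v ∈ W (ε, M, i), ∀ w ∈ W (σ, M, j), v + w ∈ W (1, 0, i + j)
  /-- The coset rule of bisection: bi-additives of two spinors of equal parity lie in `M`, those of
  two spinors of different parity lie in `C - M`. -/
  bisection_rule : ∀ (ε σ : ZMod 2) (M : MaxBisub C) (i j : BitStr r),
    ∀ v ∈ W (ε, M, i), ∀ w ∈ W (σ, M, j), v + w ∈ M.1 ↔ ε = σ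
  /-- The quaternion condition of closure
  `[W^ε(M, B; i), W^σ(M', B; j)] ⊆ W^(ε+σ)(M ⊓ M', B; i + j)`. -/
  closure : ∀ g h, ∀ X ∈ spinorSpan (W g), ∀ Y ∈ spinorSpan (W h),
    ⁅X, Y⁆ ∈ spinorSpan (W (g + h))

/-- A quotient algebra partition of rank `r` over `su(N)`: one over `su(2^p)` whose members still
form a partition, i.e. a direct sum decomposition, of `su(N)` after the removing process. -/
structure IsQuotientAlgebraPartitionOver {p r N : ℕ} (U : Matrix.unitaryGroup (Fin N) ℂ)
    (C B : AddSubgroup (SpinorLabel p)) (W : TriIndex C r → Set (SpinorLabel p)) : Prop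
    extends IsQuotientAlgebraPartition C B W where
  indep : iSupIndep fun g => removed U (W g)
  span : ⨆ g, removed U (W g) = ⊤

end

/-!
Write `G = Z_2^p`, and call *multiplier* with symbol `f` the operator on `2^p × 2^p` matrices that has
the spinor `S_v` as eigenvector of eigenvalue `f v`. On the entries `(x, x + α)` it is a convolution
on `G`, whose kernel is the inverse Fourier transform of `f (·, α)`. The image `V` of `su(N)` consists
of the traceless skew-Hermitian matrices supported on `A × A`, where `A ⊆ G` is the set of the first
`N` basis vectors; the basis `U` plays no role.

*From a partition to a Cartan decomposition* (`isCartanDecomposition_of_partition`). A maximal subgroup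
`H` of a group of exponent `2` has index `2`, so the closure rule gives the bracket relations for the
labels `T = ⋃_{g ∈ H} W g`. Since the removed members span `su(N)`, their sums over `H` and over its
complement exhaust the removed spans of `T` and of its complement.

*From a Cartan decomposition to a partition.* The Cartan involution is the multiplier with symbol `1` on
`T` and `-1` off `T`; complexified, it is an automorphism of `sl(N)`. It maps `E_{xy}`, `x ≠ y`, to a
combination of matrix units `E_{x+d,y+d}`, and comparing roots shows that the kernel on the diagonal
has the differences of a point mass at `d` in the direction `α = x + y` (`IsBlockAutomorphism.kernel_sub`; here
`N > 2^(p-1)` is needed). A combinatorial argument (`eq_or_eq_of_sub_eq`) then leaves two cases: all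
`E_{xy}` go to multiples of `E_{x+d,y+d}`, or all go to multiples of `E_{y+d,x+d}`, with one `d` that
stabilises `A`. The factors depend only on `x + y`, and by `[E_{xy}, E_{yz}] = E_{xz}` they form a
character up to a sign. So the symbol is `(-1)^τ` with
`τ(ζ, α) = a (1 + ζ·α) + ζ₀·α + ζ·d` away from the label `0` (`IsBlockAutomorphism.exists_form`), and
the label `0` is irrelevant because `V` is traceless.

Such a `τ` is a character of the tri-addition for the partition generated by the diagonal spinors
`S^ζ_0`, in which `(ζ, α)` has the index `(1 + ζ·α, {S^ξ_0 : ξ·α = 0}, ζ·d)`; the last component, and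
with it the rank `1`, is only there if `d ≠ 0`. The projections onto the members are polynomials in the
transposition, the translation by `d`, and the restrictions to the entries `(x, x + α)`. All of these
preserve `V`, so the members still partition `su(N)` after removal.
-/

noncomputable section

attribute [local instance] LieRing.ofAssociativeRing

/-! ### Binary strings and signs -/

theorem BitStr.two_eq_zero (p : ℕ) : (2 : BitStr p) = 0 := by
  funext k; exact (by decide : (2 : ZMod 2) = 0)

theorem BitStr.add_self {p : ℕ} (x : BitStr p) : x + x = 0 := by
  linear_combination x * BitStr.two_eq_zero p

theorem BitStr.add_eq_iff {p : ℕ} {x y z : BitStr p} : x + y = z ↔ x = z + y := by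
  constructor <;> intro h
  · linear_combination h - y * BitStr.two_eq_zero p
  · linear_combination h + y * BitStr.two_eq_zero p

theorem BitStr.add_eq_zero_iff {p : ℕ} {x y : BitStr p} : x + y = 0 ↔ x = y := by
  rw [BitStr.add_eq_iff, zero_add]

theorem ZMod.two_cases (a : ZMod 2) : a = 0 ∨ a = 1 := by
  revert a; decide

/-- The sign `(-1)^a` of a bit. -/
def bitSign (a : ZMod 2) : ℂ := (-1) ^ a.val

@[simp] theorem bitSign_zero : bitSign 0 = 1 := by simp [bitSign]

@[simp] theorem bitSign_one : bitSign 1 = -1 := by simp [bitSign, ZMod.val_one]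

theorem bitSign_add (a b : ZMod 2) : bitSign (a + b) = bitSign a * bitSign b := by
  have h : (1 + 1 : ZMod 2) = 0 := by decide
  rcases ZMod.two_cases a with rfl | rfl <;> rcases ZMod.two_cases b with rfl | rfl <;> simp [h]

theorem bitSign_mul_self (a : ZMod 2) : bitSign a * bitSign a = 1 := by
  rcases ZMod.two_cases a with rfl | rfl <;> simp

theorem bitSign_ne_zero (a : ZMod 2) : bitSign a ≠ 0 :=
  left_ne_zero_of_mul_eq_one (bitSign_mul_self a)

theorem bitSign_injective : Function.Injective bitSign := by
  intro a b h
  rcases ZMod.two_cases a with rfl | rfl <;> rcases ZMod.two_cases b with rfl | rfl <;>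
    first | rfl | norm_num at h

theorem star_bitSign (a : ZMod 2) : star (bitSign a) = bitSign a := by
  simp [bitSign]

/-- Orthogonality of the characters of `Z_2^p`. -/
theorem sum_bitSign_dotProduct {p : ℕ} (ζ : BitStr p) :
    ∑ x : BitStr p, bitSign (ζ ⬝ᵥ x) = if ζ = 0 then 2 ^ p else 0 := by
  split_ifs with h
  · simp [h]
  · obtain ⟨k, hk⟩ := Function.ne_iff.1 h
    have hk1 : ζ k = 1 := (ZMod.two_cases _).resolve_left hk
    have h1 := Equiv.sum_comp (Equiv.addRight (Pi.single k 1 : BitStr p))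
      fun x => bitSign (ζ ⬝ᵥ x)
    simp only [Equiv.coe_addRight, dotProduct_add, dotProduct_single, hk1, mul_one, bitSign_add,
      bitSign_one, ← Finset.sum_mul] at h1
    linear_combination (-1 / 2 : ℂ) * h1

theorem sum_bitSign_dotProduct' {p : ℕ} (x : BitStr p) :
    ∑ ζ : BitStr p, bitSign (ζ ⬝ᵥ x) = if x = 0 then 2 ^ p else 0 := by
  simp_rw [dotProduct_comm _ x]
  exact sum_bitSign_dotProduct x

/-! ### Products, adjoints and spans of spinors -/

theorem spinor_apply {p : ℕ} (v : SpinorLabel p) (x y : BitStr p) :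
    spinor v x y = if y = x + v.2 then bitSign (v.1 ⬝ᵥ x) else 0 := rfl

theorem spinor_zero (p : ℕ) : spinor (0 : SpinorLabel p) = 1 := by
  ext x y
  simp [spinor_apply, Matrix.one_apply, eq_comm]

theorem spinor_mul {p : ℕ} (v w : SpinorLabel p) :
    spinor v * spinor w = bitSign (w.1 ⬝ᵥ v.2) • spinor (v + w) := by
  ext x y
  rw [Matrix.mul_apply, Finset.sum_eq_single (x + v.2)]
  · simp only [spinor_apply, if_true, Matrix.smul_apply, smul_eq_mul, Prod.snd_add, Prod.fst_add,
      dotProduct_add, add_dotProduct, bitSign_add, add_assoc]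
    split_ifs <;> ring
  · intro z _ hz
    simp [spinor_apply, hz]
  · simp

theorem spinor_transpose {p : ℕ} (v : SpinorLabel p) :
    (spinor v)ᵀ = bitSign (v.1 ⬝ᵥ v.2) • spinor v := by
  ext x y
  simp only [Matrix.transpose_apply, spinor_apply, Matrix.smul_apply, smul_eq_mul]
  have : x = y + v.2 ↔ y = x + v.2 := by
    rw [← BitStr.add_eq_iff, eq_comm]
  by_cases h : y = x + v.2
  · rw [if_pos h, if_pos (this.2 h), h, dotProduct_add, bitSign_add, mul_comm]
  · rw [if_neg h, if_neg (this.not.2 h), mul_zero]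

theorem spinor_map_star {p : ℕ} (v : SpinorLabel p) : (spinor v).map star = spinor v := by
  ext x y
  simp only [Matrix.map_apply, spinor_apply]
  split_ifs
  · exact star_bitSign _
  · exact star_zero _

theorem spinor_conjTranspose {p : ℕ} (v : SpinorLabel p) :
    (spinor v)ᴴ = bitSign (v.1 ⬝ᵥ v.2) • spinor v := by
  rw [← spinor_transpose, Matrix.conjTranspose, Matrix.transpose_map, spinor_map_star]

theorem spinor_ne_zero {p : ℕ} (v : SpinorLabel p) : spinor v ≠ 0 := by
  intro h
  have := congrFun (congrFun h 0) (0 + v.2)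
  rw [spinor_apply, if_pos rfl] at this
  exact bitSign_ne_zero _ this

theorem trace_spinor {p : ℕ} {v : SpinorLabel p} (hv : v ≠ 0) : (spinor v).trace = 0 := by
  simp only [Matrix.trace, Matrix.diag, spinor_apply]
  by_cases h : v.2 = 0
  · have h1 : v.1 ≠ 0 := fun h1 => hv (Prod.ext h1 h)
    simp [h, sum_bitSign_dotProduct, h1]
  · simp [h]

theorem commute_spinor_iff {p : ℕ} {v w : SpinorLabel p} :
    Commute (spinor v) (spinor w) ↔ v.1 ⬝ᵥ w.2 = w.1 ⬝ᵥ v.2 := by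
  rw [commute_iff_eq, spinor_mul, spinor_mul, add_comm w v]
  constructor
  · intro h
    exact (bitSign_injective (smul_left_injective ℂ (spinor_ne_zero (v + w)) h)).symm
  · intro h
    rw [h]

/-- The phase that makes a spinor skew-Hermitian. -/
def spinorPhase {p : ℕ} (v : SpinorLabel p) : ℂ :=
  Complex.I * (-Complex.I) ^ (∑ k, (v.1 k).val * (v.2 k).val)

theorem skewSpinor_eq {p : ℕ} (v : SpinorLabel p) : skewSpinor v = spinorPhase v • spinor v := rfl

theorem spinorPhase_ne_zero {p : ℕ} (v : SpinorLabel p) : spinorPhase v ≠ 0 := by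
  simp [spinorPhase, Complex.I_ne_zero]

theorem star_spinorPhase {p : ℕ} (v : SpinorLabel p) :
    star (spinorPhase v) * bitSign (v.1 ⬝ᵥ v.2) = -spinorPhase v := by
  have h : bitSign (v.1 ⬝ᵥ v.2) = (-1) ^ (∑ k, (v.1 k).val * (v.2 k).val) := by
    have h1 : v.1 ⬝ᵥ v.2 = ((∑ k, (v.1 k).val * (v.2 k).val : ℕ) : ZMod 2) := by
      simp [dotProduct]
    rw [bitSign, h1, ZMod.val_natCast, ← neg_one_pow_eq_pow_mod_two]
  rw [h, spinorPhase, star_mul', star_pow, star_neg]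
  simp only [RCLike.star_def, Complex.conj_I, neg_neg]
  rw [mul_assoc, ← mul_pow]
  simp

theorem skewSpinor_conjTranspose {p : ℕ} (v : SpinorLabel p) :
    (skewSpinor v)ᴴ = -skewSpinor v := by
  rw [skewSpinor_eq, Matrix.conjTranspose_smul, spinor_conjTranspose, smul_smul,
    star_spinorPhase, neg_smul]

theorem skewSpinor_ne_zero {p : ℕ} (v : SpinorLabel p) : skewSpinor v ≠ 0 :=
  smul_ne_zero (spinorPhase_ne_zero v) (spinor_ne_zero v)

theorem trace_skewSpinor {p : ℕ} {v : SpinorLabel p} (hv : v ≠ 0) :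
    (skewSpinor v).trace = 0 := by
  rw [skewSpinor_eq, Matrix.trace_smul, trace_spinor hv, smul_zero]

/-- The commutator of two spinors is a multiple, possibly zero, of the spinor labelled by their
bi-addition; with skew-Hermitian normalisations the factor is real. -/
theorem lie_skewSpinor_mem {p : ℕ} (v w : SpinorLabel p) :
    ∃ c : ℝ, ⁅skewSpinor v, skewSpinor w⁆ = c • skewSpinor (v + w) := by
  obtain ⟨z, hz⟩ : ∃ z : ℂ, ⁅skewSpinor v, skewSpinor w⁆ = z • skewSpinor (v + w) := by
    refine ⟨spinorPhase v * spinorPhase w * (bitSign (w.1 ⬝ᵥ v.2) - bitSign (v.1 ⬝ᵥ w.2)) *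
      (spinorPhase (v + w))⁻¹, ?_⟩
    simp only [skewSpinor_eq, Ring.lie_def, Matrix.smul_mul, Matrix.mul_smul, spinor_mul,
      smul_smul, add_comm w v, ← sub_smul]
    congr 1
    field_simp [spinorPhase_ne_zero (v + w)]
  -- Both sides are skew-Hermitian, so the factor is real.
  have h1 : (⁅skewSpinor v, skewSpinor w⁆)ᴴ = -⁅skewSpinor v, skewSpinor w⁆ := by
    rw [Ring.lie_def, Matrix.conjTranspose_sub, Matrix.conjTranspose_mul,
      Matrix.conjTranspose_mul, skewSpinor_conjTranspose, skewSpinor_conjTranspose]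
    simp
  rw [hz, Matrix.conjTranspose_smul, skewSpinor_conjTranspose, smul_neg, neg_inj] at h1
  have h2 := smul_left_injective ℂ (skewSpinor_ne_zero (v + w)) h1
  obtain ⟨c, hc⟩ := Complex.conj_eq_iff_real.1 h2
  exact ⟨c, by rw [hz, hc]; rfl⟩

theorem lie_skewSpinor_eq_zero {p : ℕ} {v w : SpinorLabel p}
    (h : Commute (spinor v) (spinor w)) : ⁅skewSpinor v, skewSpinor w⁆ = 0 := by
  rw [skewSpinor_eq, skewSpinor_eq, Ring.lie_def, sub_eq_zero]
  exact (h.smul_left _).smul_right _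

theorem trace_skewSpinor_mul {p : ℕ} {v w : SpinorLabel p} (h : v ≠ w) :
    (skewSpinor v * skewSpinor w).trace = 0 := by
  rw [skewSpinor_eq, skewSpinor_eq, Matrix.smul_mul, Matrix.mul_smul, spinor_mul]
  have h1 : v + w ≠ 0 := fun h1 => h <| by
    rw [← SpinorLabel.neg_eq w]; exact eq_neg_of_add_eq_zero_left h1
  simp [trace_spinor h1]

theorem skewSpinor_mem_spinorSpan {p : ℕ} {T : Set (SpinorLabel p)} {v : SpinorLabel p}
    (hv : v ∈ T) : skewSpinor v ∈ spinorSpan T :=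
  Submodule.subset_span ⟨v, hv, rfl⟩

theorem spinorSpan_mono {p : ℕ} {S T : Set (SpinorLabel p)} (h : S ⊆ T) :
    spinorSpan S ≤ spinorSpan T :=
  Submodule.span_mono (Set.image_mono h)

theorem spinorSpan_induction {p : ℕ} {T : Set (SpinorLabel p)}
    (P : Matrix (BitStr p) (BitStr p) ℂ → Prop) (h : ∀ v ∈ T, P (skewSpinor v)) (h0 : P 0)
    (hadd : ∀ X Y, P X → P Y → P (X + Y)) (hsmul : ∀ (c : ℝ) X, P X → P (c • X))
    {X : Matrix (BitStr p) (BitStr p) ℂ} (hX : X ∈ spinorSpan T) : P X := by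
  refine Submodule.span_induction ?_ h0 (fun X Y _ _ => hadd X Y) (fun c X _ => hsmul c X) hX
  rintro _ ⟨v, hv, rfl⟩
  exact h v hv

/-- Commutators of spans of spinors are controlled by the noncommuting pairs of labels. -/
theorem lie_mem_spinorSpan {p : ℕ} {S T R : Set (SpinorLabel p)}
    (h : ∀ v ∈ S, ∀ w ∈ T, ¬Commute (spinor v) (spinor w) → v + w ∈ R)
    {X Y : Matrix (BitStr p) (BitStr p) ℂ} (hX : X ∈ spinorSpan S) (hY : Y ∈ spinorSpan T) :
    ⁅X, Y⁆ ∈ spinorSpan R := by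
  refine spinorSpan_induction (fun X => ⁅X, Y⁆ ∈ spinorSpan R) ?_ ?_ ?_ ?_ hX
  · intro v hv
    refine spinorSpan_induction (fun Y => ⁅skewSpinor v, Y⁆ ∈ spinorSpan R) ?_ ?_ ?_ ?_ hY
    · intro w hw
      by_cases hc : Commute (spinor v) (spinor w)
      · rw [lie_skewSpinor_eq_zero hc]
        exact Submodule.zero_mem _
      · obtain ⟨c, hc'⟩ := lie_skewSpinor_mem v w
        rw [hc']
        exact Submodule.smul_mem _ _ (skewSpinor_mem_spinorSpan (h v hv w hw hc))
    · simp
    · intro X Y hX hY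
      rw [lie_add]
      exact Submodule.add_mem _ hX hY
    · intro c X hX
      rw [Ring.lie_def, Matrix.mul_smul, Matrix.smul_mul, ← smul_sub, ← Ring.lie_def]
      exact Submodule.smul_mem _ _ hX
  · simp
  · intro X Y hX hY
    rw [add_lie]
    exact Submodule.add_mem _ hX hY
  · intro c X hX
    rw [Ring.lie_def, Matrix.mul_smul, Matrix.smul_mul, ← smul_sub, ← Ring.lie_def]
    exact Submodule.smul_mem _ _ hX

theorem trace_mul_of_mem_spinorSpan {p : ℕ} {S T : Set (SpinorLabel p)} (h : Disjoint S T)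
    {X Y : Matrix (BitStr p) (BitStr p) ℂ} (hX : X ∈ spinorSpan S) (hY : Y ∈ spinorSpan T) :
    (X * Y).trace = 0 := by
  refine spinorSpan_induction (fun X => (X * Y).trace = 0) ?_ ?_ ?_ ?_ hX
  · intro v hv
    refine spinorSpan_induction (fun Y => (skewSpinor v * Y).trace = 0) ?_ ?_ ?_ ?_ hY
    · intro w hw
      exact trace_skewSpinor_mul (h.ne_of_mem hv hw)
    · simp
    · intro X Y hX hY
      rw [mul_add, Matrix.trace_add, hX, hY, add_zero]
    · intro c X hX
      rw [Matrix.mul_smul, Matrix.trace_smul, hX, smul_zero]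
  · simp
  · intro X Y hX hY
    rw [add_mul, Matrix.trace_add, hX, hY, add_zero]
  · intro c X hX
    rw [Matrix.smul_mul, Matrix.trace_smul, hX, smul_zero]

/-- A traceless combination of spinors does not involve the identity, whose label is `0`. -/
theorem mem_spinorSpan_of_trace_eq_zero {p : ℕ} {S T : Set (SpinorLabel p)}
    (h : ∀ v ∈ S, v ≠ 0 → v ∈ T) {X : Matrix (BitStr p) (BitStr p) ℂ}
    (hX : X ∈ spinorSpan S) (htr : X.trace = 0) : X ∈ spinorSpan T := by
  have h1 : ∃ c : ℝ, ∃ Y ∈ spinorSpan T, Y.trace = 0 ∧ X = c • skewSpinor 0 + Y := by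
    refine spinorSpan_induction (fun X => ∃ c : ℝ, ∃ Y ∈ spinorSpan T, Y.trace = 0 ∧
      X = c • skewSpinor 0 + Y) ?_ ?_ ?_ ?_ hX
    · intro v hv
      by_cases h0 : v = 0
      · exact ⟨1, 0, Submodule.zero_mem _, Matrix.trace_zero _ _, by simp [h0]⟩
      · exact ⟨0, skewSpinor v, skewSpinor_mem_spinorSpan (h v hv h0), trace_skewSpinor h0,
          by simp⟩
    · exact ⟨0, 0, Submodule.zero_mem _, Matrix.trace_zero _ _, by simp⟩
    · rintro _ _ ⟨c, Y, hY, hY', rfl⟩ ⟨d, Z, hZ, hZ', rfl⟩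
      exact ⟨c + d, Y + Z, Submodule.add_mem _ hY hZ, by simp [hY', hZ'],
        by rw [add_smul]; abel⟩
    · rintro d _ ⟨c, Y, hY, hY', rfl⟩
      exact ⟨d * c, d • Y, Submodule.smul_mem _ _ hY, by simp [hY'],
        by rw [smul_add, smul_smul]⟩
  obtain ⟨c, Y, hY, hY', rfl⟩ := h1
  have h2 : (skewSpinor (0 : SpinorLabel p)).trace ≠ 0 := by
    rw [skewSpinor_eq, Matrix.trace_smul, spinor_zero, Matrix.trace_one]
    exact smul_ne_zero (spinorPhase_ne_zero 0) (Nat.cast_ne_zero.2 Fintype.card_ne_zero)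
  rw [Matrix.trace_add, hY', add_zero, Matrix.trace_smul] at htr
  have h3 : c = 0 := by simpa [h2] using htr
  rw [h3, zero_smul, zero_add]
  exact hY

/-- Matrix units are combinations of spinors, by Fourier inversion on `Z_2^p`. -/
theorem single_eq_sum_spinor {p : ℕ} (x y : BitStr p) :
    Matrix.single x y (1 : ℂ) =
      ∑ ζ : BitStr p, ((2 ^ p)⁻¹ * bitSign (ζ ⬝ᵥ x)) • spinor (ζ, x + y) := by
  ext z w
  rw [Matrix.sum_apply]
  simp only [Matrix.smul_apply, spinor_apply, smul_eq_mul, Matrix.single_apply]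
  by_cases h : w = z + (x + y)
  · simp only [if_pos h, mul_assoc, ← bitSign_add, ← dotProduct_add]
    rw [← Finset.mul_sum, sum_bitSign_dotProduct']
    simp only [BitStr.add_eq_zero_iff]
    by_cases hx : x = z
    · have hy : y = w := by
        rw [h, hx]; linear_combination -z * BitStr.two_eq_zero p
      simp [hx, hy]
    · simp [hx]
  · have : ¬(x = z ∧ y = w) := by
      rintro ⟨rfl, rfl⟩
      exact h (by linear_combination -x * BitStr.two_eq_zero p)
    simp [h, this]

theorem span_spinor {p : ℕ} : Submodule.span ℂ (Set.range (spinor (p := p))) = ⊤ := by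
  rw [eq_top_iff]
  intro X _
  rw [Matrix.matrix_eq_sum_single X]
  refine Submodule.sum_mem _ fun x _ => Submodule.sum_mem _ fun y _ => ?_
  have : Matrix.single x y (X x y) = X x y • Matrix.single x y (1 : ℂ) := by simp
  rw [this, single_eq_sum_spinor]
  exact Submodule.smul_mem _ _ (Submodule.sum_mem _ fun ζ _ => Submodule.smul_mem _ _
    (Submodule.subset_span ⟨_, rfl⟩))

theorem linearMap_ext_spinor {p : ℕ}
    {f g : Matrix (BitStr p) (BitStr p) ℂ →ₗ[ℂ] Matrix (BitStr p) (BitStr p) ℂ}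
    (h : ∀ v, f (spinor v) = g (spinor v)) : f = g :=
  LinearMap.ext_on_range span_spinor h

/-- The skew-Hermitian matrices are the real span of all skew-Hermitian spinors. -/
theorem mem_spinorSpan_univ {p : ℕ} {X : Matrix (BitStr p) (BitStr p) ℂ} (hX : Xᴴ = -X) :
    X ∈ spinorSpan (Set.univ : Set (SpinorLabel p)) := by
  have h1 : X ∈ Submodule.span ℂ (Set.range (spinor (p := p))) := span_spinor ▸ trivial
  obtain ⟨a, ha⟩ := (Submodule.mem_span_range_iff_exists_fun ℂ).1 h1
  obtain ⟨b, h2⟩ : ∃ b : SpinorLabel p → ℂ, X = ∑ v, b v • skewSpinor v := by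
    refine ⟨fun v => a v * (spinorPhase v)⁻¹, ?_⟩
    rw [← ha]
    refine Finset.sum_congr rfl fun v _ => ?_
    rw [skewSpinor_eq, smul_smul, inv_mul_cancel_right₀ (spinorPhase_ne_zero v)]
  -- Taking skew-Hermitian parts replaces the coefficients by their real parts.
  have h3 : X = ∑ v, (b v).re • skewSpinor v := by
    have h4 : X = (2⁻¹ : ℂ) • (X - Xᴴ) := by
      rw [hX, sub_neg_eq_add, ← two_smul ℂ X, smul_smul]; norm_num
    rw [h4]
    nth_rewrite 2 [h2]
    nth_rewrite 1 [h2]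
    rw [Matrix.conjTranspose_sum, ← Finset.sum_sub_distrib, Finset.smul_sum]
    refine Finset.sum_congr rfl fun v _ => ?_
    rw [Matrix.conjTranspose_smul, skewSpinor_conjTranspose, smul_neg, sub_neg_eq_add, ← add_smul,
      smul_smul, RCLike.star_def, Complex.add_conj]
    ext i j
    simp
  rw [h3]
  exact Submodule.sum_mem _ fun v _ => Submodule.smul_mem _ _
    (skewSpinor_mem_spinorSpan (Set.mem_univ v))

/-! ### Multipliers: operators that are diagonal in the basis of spinors -/

/-- The inverse Fourier transform in the phase string of a function of labels. -/
def multiplierKernel {p : ℕ} (f : SpinorLabel p → ℂ) (α y : BitStr p) : ℂ :=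
  (2 ^ p)⁻¹ * ∑ ζ : BitStr p, f (ζ, α) * bitSign (ζ ⬝ᵥ y)

/-- The operator with eigenvector `S_v` of eigenvalue `f v`, for every label `v`. On the entries
`(x, x + α)` of a matrix it is the convolution with a function on `Z_2^p`. -/
def multiplier {p : ℕ} (f : SpinorLabel p → ℂ) :
    Matrix (BitStr p) (BitStr p) ℂ →ₗ[ℂ] Matrix (BitStr p) (BitStr p) ℂ where
  toFun X := Matrix.of fun z w => ∑ y, multiplierKernel f (z + w) y * X (z + y) (w + y)
  map_add' X Y := by
    ext z w
    simp [mul_add, Finset.sum_add_distrib]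
  map_smul' c X := by
    ext z w
    simp [Finset.mul_sum, mul_left_comm]

theorem multiplier_apply {p : ℕ} (f : SpinorLabel p → ℂ) (X : Matrix (BitStr p) (BitStr p) ℂ)
    (z w : BitStr p) :
    multiplier f X z w = ∑ y, multiplierKernel f (z + w) y * X (z + y) (w + y) := rfl

/-- Fourier inversion. -/
theorem sum_multiplierKernel {p : ℕ} (f : SpinorLabel p → ℂ) (ζ α : BitStr p) :
    ∑ y, multiplierKernel f α y * bitSign (ζ ⬝ᵥ y) = f (ζ, α) := by
  simp only [multiplierKernel, mul_assoc, Finset.sum_mul, ← Finset.mul_sum]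
  rw [Finset.sum_comm]
  simp only [← bitSign_add, ← add_dotProduct, ← Finset.mul_sum, sum_bitSign_dotProduct,
    BitStr.add_eq_zero_iff]
  simp only [mul_ite, mul_zero, Finset.sum_ite_eq', Finset.mem_univ, if_true]
  field_simp

theorem multiplier_spinor {p : ℕ} (f : SpinorLabel p → ℂ) (v : SpinorLabel p) :
    multiplier f (spinor v) = f v • spinor v := by
  ext z w
  rw [multiplier_apply, Matrix.smul_apply, smul_eq_mul]
  simp only [spinor_apply]
  by_cases h : w = z + v.2
  · have h1 : z + w = v.2 := by rw [h]; linear_combination z * BitStr.two_eq_zero p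
    have h2 : ∀ y, w + y = z + y + v.2 := fun y => by rw [h]; abel
    simp only [h2, if_true, if_pos h, h1, dotProduct_add, bitSign_add]
    rw [← Prod.mk.eta (p := v), ← sum_multiplierKernel f v.1 v.2, Finset.sum_mul]
    exact Finset.sum_congr rfl fun y _ => by ring
  · have h2 : ∀ y, ¬w + y = z + y + v.2 := fun y hy => h (by linear_combination hy)
    simp [h, h2]

theorem multiplier_skewSpinor {p : ℕ} (f : SpinorLabel p → ℂ) (v : SpinorLabel p) :
    multiplier f (skewSpinor v) = f v • skewSpinor v := by
  rw [skewSpinor_eq, map_smul, multiplier_spinor, smul_comm]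

theorem multiplier_add {p : ℕ} (f g : SpinorLabel p → ℂ) (X : Matrix (BitStr p) (BitStr p) ℂ) :
    multiplier (f + g) X = multiplier f X + multiplier g X :=
  LinearMap.congr_fun (g := multiplier f + multiplier g)
    (linearMap_ext_spinor fun v => by simp [multiplier_spinor, add_smul]) X

theorem multiplier_mul {p : ℕ} (f g : SpinorLabel p → ℂ) (X : Matrix (BitStr p) (BitStr p) ℂ) :
    multiplier (f * g) X = multiplier f (multiplier g X) :=
  LinearMap.congr_fun (g := multiplier f ∘ₗ multiplier g)
    (linearMap_ext_spinor fun v => by simp [multiplier_spinor, smul_smul, mul_comm]) X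

theorem multiplier_const {p : ℕ} (c : ℂ) (X : Matrix (BitStr p) (BitStr p) ℂ) :
    multiplier (fun _ => c) X = c • X :=
  LinearMap.congr_fun (g := c • LinearMap.id)
    (linearMap_ext_spinor fun v => by simp [multiplier_spinor]) X

theorem multiplier_sum {p : ℕ} {ι : Type*} (s : Finset ι) (f : ι → SpinorLabel p → ℂ)
    (X : Matrix (BitStr p) (BitStr p) ℂ) :
    multiplier (∑ i ∈ s, f i) X = ∑ i ∈ s, multiplier (f i) X := by
  classical
  induction s using Finset.induction_on with
  | empty =>
    have h := multiplier_const 0 X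
    rw [zero_smul] at h
    rw [Finset.sum_empty, Finset.sum_empty]
    exact h
  | insert i s hi ih => rw [Finset.sum_insert hi, Finset.sum_insert hi, multiplier_add, ih]

theorem multiplier_transpose {p : ℕ} (X : Matrix (BitStr p) (BitStr p) ℂ) :
    multiplier (fun v => bitSign (v.1 ⬝ᵥ v.2)) X = Xᵀ :=
  LinearMap.congr_fun (g := (Matrix.transposeLinearEquiv (BitStr p) (BitStr p) ℂ ℂ).toLinearMap)
    (linearMap_ext_spinor fun v => by simp [multiplier_spinor, spinor_transpose]) X

theorem multiplier_translate {p : ℕ} (d : BitStr p) (X : Matrix (BitStr p) (BitStr p) ℂ) :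
    multiplier (fun v => bitSign (v.1 ⬝ᵥ d)) X = X.submatrix (· + d) (· + d) := by
  have h : ∀ α y : BitStr p, multiplierKernel (fun v => bitSign (v.1 ⬝ᵥ d)) α y =
      if y = d then 1 else 0 := by
    intro α y
    simp only [multiplierKernel, ← bitSign_add, ← dotProduct_add, sum_bitSign_dotProduct',
      BitStr.add_eq_zero_iff, eq_comm (a := d)]
    split_ifs <;> simp
  ext z w
  simp [multiplier_apply, h]

open Classical in
theorem multiplier_diagonal {p : ℕ} (α : BitStr p) (X : Matrix (BitStr p) (BitStr p) ℂ) :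
    multiplier (fun v => if v.2 = α then 1 else 0) X =
      Matrix.of fun z w => if z + w = α then X z w else 0 := by
  ext z w
  rw [multiplier_apply, Finset.sum_eq_single 0]
  · by_cases h : z + w = α <;> simp [multiplierKernel, h]
  · intro y _ hy
    simp [multiplierKernel, sum_bitSign_dotProduct', hy]
  · simp

theorem multiplier_eq_of_mem {p : ℕ} {f : SpinorLabel p → ℂ} {S : Set (SpinorLabel p)} {c : ℝ}
    (h : ∀ v ∈ S, f v = c) {X : Matrix (BitStr p) (BitStr p) ℂ} (hX : X ∈ spinorSpan S) :
    multiplier f X = c • X := by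
  refine spinorSpan_induction (fun X => multiplier f X = c • X) ?_ ?_ ?_ ?_ hX
  · intro v hv
    rw [multiplier_skewSpinor, h v hv]
    ext i j
    simp
  · simp
  · intro X Y hX hY
    rw [map_add, hX, hY, smul_add]
  · intro a X hX
    rw [LinearMap.map_smul_of_tower, hX, smul_comm]

/-- The characteristic function of a set of labels; its multiplier is the projection onto the span
of the spinors with label in this set. -/
def labelIndicator {p : ℕ} (S : Set (SpinorLabel p)) : SpinorLabel p → ℂ :=
  S.indicator 1

theorem multiplier_labelIndicator_mem {p : ℕ} (S : Set (SpinorLabel p))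
    {X : Matrix (BitStr p) (BitStr p) ℂ} (hX : Xᴴ = -X) :
    multiplier (labelIndicator S) X ∈ spinorSpan S := by
  refine spinorSpan_induction (fun X => multiplier (labelIndicator S) X ∈ spinorSpan S)
    ?_ ?_ ?_ ?_ (mem_spinorSpan_univ hX)
  · intro v _
    rw [multiplier_skewSpinor]
    by_cases hv : v ∈ S
    · simpa [labelIndicator, hv] using skewSpinor_mem_spinorSpan hv
    · simp [labelIndicator, hv]
  · simp
  · intro X Y hX hY
    rw [map_add]
    exact Submodule.add_mem _ hX hY
  · intro a X hX
    rw [LinearMap.map_smul_of_tower]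
    exact Submodule.smul_mem _ _ hX

theorem disjoint_spinorSpan {p : ℕ} {S T : Set (SpinorLabel p)} (h : Disjoint S T) :
    Disjoint (spinorSpan S) (spinorSpan T) := by
  rw [Submodule.disjoint_def]
  intro X hS hT
  have h1 := multiplier_eq_of_mem (f := labelIndicator S) (c := 1)
    (fun v hv => by simp [labelIndicator, hv]) hS
  have h2 := multiplier_eq_of_mem (f := labelIndicator S) (c := 0)
    (fun v hv => by simp [labelIndicator, Set.disjoint_right.1 h hv]) hT
  rw [h1] at h2
  simpa using h2

/-! ### The block of `su(N)` in `su(2^p)` -/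

/-- The first `N` computational basis vectors. -/
def blockSet (p N : ℕ) : Set (BitStr p) := Set.range (bits p : Fin N → BitStr p)

theorem bits_injective {p N : ℕ} (hN : N ≤ 2 ^ p) :
    Function.Injective (bits p : Fin N → BitStr p) := by
  intro i j h
  apply Fin.ext
  apply Nat.eq_of_testBit_eq
  intro k
  by_cases hk : k < p
  · have h1 := congrFun h (Fin.rev ⟨k, hk⟩)
    simp only [bits, Fin.rev_rev] at h1
    by_cases hi : (i : ℕ).testBit k <;> by_cases hj : (j : ℕ).testBit k <;>
      simp [hi, hj] at h1 ⊢
  · have hp : 2 ^ p ≤ 2 ^ k := Nat.pow_le_pow_right two_pos (not_lt.1 hk)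
    rw [Nat.testBit_lt_two_pow ((i.2.trans_le hN).trans_le hp),
      Nat.testBit_lt_two_pow ((j.2.trans_le hN).trans_le hp)]

theorem mem_blockSet_of_leading_eq_zero {n N : ℕ} (hN : 2 ^ n < N) {x : BitStr (n + 1)}
    (hx : x 0 = 0) : x ∈ blockSet (n + 1) N := by
  have hb : Function.Bijective (bits (n + 1) : Fin (2 ^ (n + 1)) → BitStr (n + 1)) := by
    rw [Fintype.bijective_iff_injective_and_card]
    exact ⟨bits_injective le_rfl, by simp [ZMod.card]⟩
  obtain ⟨i, rfl⟩ := hb.2 x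
  have h1 : (i : ℕ).testBit n = false := by
    simpa [bits, Fin.rev] using hx
  have h2 : (i : ℕ) < 2 ^ n := by
    apply Nat.lt_pow_two_of_testBit
    intro k hk
    rcases hk.eq_or_lt with rfl | hk
    · exact h1
    · exact Nat.testBit_lt_two_pow (i.2.trans_le (Nat.pow_le_pow_right two_pos hk))
  exact ⟨⟨i, h2.trans hN⟩, rfl⟩

theorem single_mem_blockSet {n N : ℕ} (hN : 2 ^ n < N) :
    (Pi.single 0 1 : BitStr (n + 1)) ∈ blockSet (n + 1) N := by
  refine ⟨⟨2 ^ n, hN⟩, ?_⟩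
  funext k
  simp only [bits, Nat.testBit_two_pow, Pi.single_apply, Fin.ext_iff, Fin.val_rev, Fin.val_zero]
  congr 1
  simp only [decide_eq_true_eq, eq_iff_iff]
  have := k.2
  omega

theorem blockIncl_conjTranspose_mul {p N : ℕ} (hN : N ≤ 2 ^ p) :
    (blockIncl p N)ᴴ * blockIncl p N = 1 := by
  ext i j
  simp only [Matrix.mul_apply, Matrix.conjTranspose_apply, blockIncl, Matrix.of_apply,
    Matrix.one_apply]
  rw [Finset.sum_eq_single (bits p i)]
  · simp [(bits_injective hN).eq_iff]
  · intro x _ hx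
    simp [hx]
  · simp

open Classical in
theorem blockIncl_mul_conjTranspose {p N : ℕ} (hN : N ≤ 2 ^ p) :
    blockIncl p N * (blockIncl p N)ᴴ =
      Matrix.diagonal fun x => if x ∈ blockSet p N then 1 else 0 := by
  ext x y
  simp only [Matrix.mul_apply, Matrix.conjTranspose_apply, blockIncl, Matrix.of_apply,
    Matrix.diagonal_apply]
  by_cases hx : x ∈ blockSet p N
  · obtain ⟨i, rfl⟩ := hx
    rw [Finset.sum_eq_single i]
    · simp [blockSet, eq_comm]
    · intro j _ hj
      simp [(bits_injective hN).eq_iff, hj.symm]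
    · simp
  · have : ∀ i : Fin N, x ≠ bits p i := fun i hi => hx ⟨i, hi.symm⟩
    simp [this, hx]

/-- The isometry `ℂ^N → ℂ^(2^p)` that takes the basis `U` to the first `N` basis vectors. -/
def blockIsometry (p : ℕ) {N : ℕ} (U : Matrix.unitaryGroup (Fin N) ℂ) :
    Matrix (BitStr p) (Fin N) ℂ :=
  blockIncl p N * (U : Matrix (Fin N) (Fin N) ℂ)ᴴ

theorem blockIsometry_conjTranspose_mul {p N : ℕ} (hN : N ≤ 2 ^ p)
    (U : Matrix.unitaryGroup (Fin N) ℂ) : (blockIsometry p U)ᴴ * blockIsometry p U = 1 := by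
  rw [blockIsometry, Matrix.conjTranspose_mul, Matrix.conjTranspose_conjTranspose,
    Matrix.mul_assoc, ← Matrix.mul_assoc _ (blockIncl p N), blockIncl_conjTranspose_mul hN,
    Matrix.one_mul]
  exact Matrix.mem_unitaryGroup_iff.1 U.2

theorem blockIsometry_mul_conjTranspose {p N : ℕ}
    (U : Matrix.unitaryGroup (Fin N) ℂ) :
    blockIsometry p U * (blockIsometry p U)ᴴ = blockIncl p N * (blockIncl p N)ᴴ := by
  rw [blockIsometry, Matrix.conjTranspose_mul, Matrix.conjTranspose_conjTranspose,
    Matrix.mul_assoc, ← Matrix.mul_assoc _ᴴ]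
  have : (U : Matrix (Fin N) (Fin N) ℂ)ᴴ * (U : Matrix (Fin N) (Fin N) ℂ) = 1 :=
    Matrix.mem_unitaryGroup_iff'.1 U.2
  rw [this, Matrix.one_mul]

theorem placeBlock_apply {p N : ℕ} (U : Matrix.unitaryGroup (Fin N) ℂ) (X : su N) :
    placeBlock p U X = blockIsometry p U * (X : Matrix (Fin N) (Fin N) ℂ) *
      (blockIsometry p U)ᴴ := rfl

/-- Matrices supported on the upper left `N × N` block. -/
def IsBlock (p N : ℕ) (Y : Matrix (BitStr p) (BitStr p) ℂ) : Prop :=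
  ∀ z w, Y z w ≠ 0 → z ∈ blockSet p N ∧ w ∈ blockSet p N

theorem isBlock_iff {p N : ℕ} (hN : N ≤ 2 ^ p) {Y : Matrix (BitStr p) (BitStr p) ℂ} :
    IsBlock p N Y ↔
      blockIncl p N * (blockIncl p N)ᴴ * Y * (blockIncl p N * (blockIncl p N)ᴴ) = Y := by
  classical
  rw [blockIncl_mul_conjTranspose hN, ← Matrix.ext_iff]
  simp only [Matrix.mul_diagonal, Matrix.diagonal_mul]
  refine forall₂_congr fun z w => ?_
  by_cases hz : z ∈ blockSet p N <;> by_cases hw : w ∈ blockSet p N <;>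
    simp [hz, hw, eq_comm]

theorem mul_placeBlock_mul {p N : ℕ} (hN : N ≤ 2 ^ p) (U : Matrix.unitaryGroup (Fin N) ℂ)
    (X : su N) : (blockIsometry p U)ᴴ * placeBlock p U X * blockIsometry p U =
      (X : Matrix (Fin N) (Fin N) ℂ) := by
  have h := blockIsometry_conjTranspose_mul hN U
  rw [placeBlock_apply, Matrix.mul_assoc, Matrix.mul_assoc _ _ (blockIsometry p U), h,
    Matrix.mul_one, ← Matrix.mul_assoc, h, Matrix.one_mul]

theorem placeBlock_injective {p N : ℕ} (hN : N ≤ 2 ^ p) (U : Matrix.unitaryGroup (Fin N) ℂ) :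
    Function.Injective (placeBlock p U) := by
  intro X Y h
  apply Subtype.ext
  rw [← mul_placeBlock_mul hN U X, h, mul_placeBlock_mul hN U Y]

theorem placeBlock_mul_placeBlock {p N : ℕ} (hN : N ≤ 2 ^ p)
    (U : Matrix.unitaryGroup (Fin N) ℂ) (X Y : su N) :
    placeBlock p U X * placeBlock p U Y = blockIsometry p U *
      ((X : Matrix (Fin N) (Fin N) ℂ) * (Y : Matrix (Fin N) (Fin N) ℂ)) *
        (blockIsometry p U)ᴴ := by
  rw [placeBlock_apply, placeBlock_apply]
  calc _ = blockIsometry p U * (X : Matrix (Fin N) (Fin N) ℂ) *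
        ((blockIsometry p U)ᴴ * blockIsometry p U) * (Y : Matrix (Fin N) (Fin N) ℂ) *
          (blockIsometry p U)ᴴ := by simp only [Matrix.mul_assoc]
    _ = _ := by
      rw [blockIsometry_conjTranspose_mul hN, Matrix.mul_one]
      simp only [Matrix.mul_assoc]

theorem placeBlock_lie {p N : ℕ} (hN : N ≤ 2 ^ p) (U : Matrix.unitaryGroup (Fin N) ℂ)
    (X Y : su N) : placeBlock p U ⁅X, Y⁆ = ⁅placeBlock p U X, placeBlock p U Y⁆ := by
  rw [Ring.lie_def, placeBlock_mul_placeBlock hN, placeBlock_mul_placeBlock hN, placeBlock_apply,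
    LieSubalgebra.coe_bracket, Ring.lie_def, Matrix.mul_sub, Matrix.sub_mul]

theorem trace_placeBlock_mul {p N : ℕ} (hN : N ≤ 2 ^ p) (U : Matrix.unitaryGroup (Fin N) ℂ)
    (X Y : su N) : (placeBlock p U X * placeBlock p U Y).trace =
      ((X : Matrix (Fin N) (Fin N) ℂ) * (Y : Matrix (Fin N) (Fin N) ℂ)).trace := by
  rw [placeBlock_mul_placeBlock hN, Matrix.trace_mul_comm, ← Matrix.mul_assoc,
    blockIsometry_conjTranspose_mul hN, Matrix.one_mul]

/-- The image of `su(N)` does not depend on the basis `U`. -/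
theorem mem_range_placeBlock_iff {p N : ℕ} (hN : N ≤ 2 ^ p)
    (U : Matrix.unitaryGroup (Fin N) ℂ) {Y : Matrix (BitStr p) (BitStr p) ℂ} :
    Y ∈ LinearMap.range (placeBlock p U) ↔ Yᴴ = -Y ∧ Y.trace = 0 ∧ IsBlock p N Y := by
  have h := blockIsometry_conjTranspose_mul hN U
  have h' := blockIsometry_mul_conjTranspose (p := p) U
  constructor
  · rintro ⟨X, rfl⟩
    refine ⟨?_, ?_, ?_⟩
    · rw [placeBlock_apply, Matrix.conjTranspose_mul, Matrix.conjTranspose_mul,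
        Matrix.conjTranspose_conjTranspose, X.2.1]
      simp [Matrix.mul_assoc]
    · rw [placeBlock_apply, Matrix.trace_mul_comm, ← Matrix.mul_assoc, h, Matrix.one_mul]
      exact X.2.2
    · rw [isBlock_iff hN, ← h', placeBlock_apply]
      calc _ = blockIsometry p U * ((blockIsometry p U)ᴴ * blockIsometry p U) *
            (X : Matrix (Fin N) (Fin N) ℂ) * ((blockIsometry p U)ᴴ * blockIsometry p U) *
              (blockIsometry p U)ᴴ := by simp only [Matrix.mul_assoc]
        _ = _ := by rw [h, Matrix.mul_one, Matrix.mul_one]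
  · rintro ⟨hY, htr, hb⟩
    rw [isBlock_iff hN, ← h'] at hb
    refine ⟨⟨(blockIsometry p U)ᴴ * Y * blockIsometry p U, ?_, ?_⟩, ?_⟩
    · rw [Matrix.conjTranspose_mul, Matrix.conjTranspose_mul,
        Matrix.conjTranspose_conjTranspose, hY]
      simp [Matrix.mul_assoc]
    · rw [← htr, Matrix.trace_mul_comm, ← Matrix.mul_assoc]
      calc _ = (blockIsometry p U * ((blockIsometry p U)ᴴ * blockIsometry p U) *
            (blockIsometry p U)ᴴ * Y).trace := by
            rw [h, Matrix.mul_one, Matrix.mul_assoc]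
        _ = (blockIsometry p U * (blockIsometry p U)ᴴ *
            (blockIsometry p U * (blockIsometry p U)ᴴ * Y)).trace := by
            simp only [Matrix.mul_assoc]
        _ = (blockIsometry p U * (blockIsometry p U)ᴴ * Y *
            (blockIsometry p U * (blockIsometry p U)ᴴ)).trace := Matrix.trace_mul_comm _ _
        _ = _ := by rw [hb]
    · rw [placeBlock_apply]
      conv_rhs => rw [← hb]
      simp only [Matrix.mul_assoc]

/-! ### The removing process -/

theorem mem_removed {p N : ℕ} {U : Matrix.unitaryGroup (Fin N) ℂ} {T : Set (SpinorLabel p)}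
    {X : su N} : X ∈ removed U T ↔ placeBlock p U X ∈ spinorSpan T := Iff.rfl

theorem removed_mono {p N : ℕ} (U : Matrix.unitaryGroup (Fin N) ℂ) {S T : Set (SpinorLabel p)}
    (h : S ⊆ T) : removed U S ≤ removed U T :=
  Submodule.comap_mono (spinorSpan_mono h)

/-- The identity spinor, with label `0`, does not matter in the removing process. -/
theorem removed_le_of_ne_zero {p N : ℕ} (hN : N ≤ 2 ^ p) (U : Matrix.unitaryGroup (Fin N) ℂ)
    {S T : Set (SpinorLabel p)} (h : ∀ v ∈ S, v ≠ 0 → v ∈ T) : removed U S ≤ removed U T :=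
  fun X hX => mem_spinorSpan_of_trace_eq_zero h hX
    ((mem_range_placeBlock_iff hN U).1 ⟨X, rfl⟩).2.1

theorem removed_empty {p N : ℕ} (hN : N ≤ 2 ^ p) (U : Matrix.unitaryGroup (Fin N) ℂ) :
    removed U (∅ : Set (SpinorLabel p)) = ⊥ := by
  rw [eq_bot_iff]
  intro X hX
  rw [mem_removed, spinorSpan, Set.image_empty, Submodule.span_empty, Submodule.mem_bot] at hX
  exact placeBlock_injective hN U (hX.trans (map_zero _).symm)

theorem disjoint_removed {p N : ℕ} (hN : N ≤ 2 ^ p) (U : Matrix.unitaryGroup (Fin N) ℂ)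
    {S T : Set (SpinorLabel p)} (h : Disjoint S T) : Disjoint (removed U S) (removed U T) := by
  rw [Submodule.disjoint_def]
  intro X hS hT
  exact placeBlock_injective hN U
    ((Submodule.disjoint_def.1 (disjoint_spinorSpan h) _ hS hT).trans (map_zero _).symm)

theorem iSupIndep_removed {p N : ℕ} (hN : N ≤ 2 ^ p) (U : Matrix.unitaryGroup (Fin N) ℂ)
    {ι : Type*} {W : ι → Set (SpinorLabel p)} (h : Pairwise fun g g' => Disjoint (W g) (W g')) :
    iSupIndep fun g => removed U (W g) := by
  rw [iSupIndep_def]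
  intro g
  refine (disjoint_removed hN U (S := W g) (T := (W g)ᶜ) disjoint_compl_right).mono_right ?_
  exact iSup₂_le fun g' hg' => removed_mono U (h hg').subset_compl_right

/-! ### From quotient algebra partitions to Cartan decompositions -/

theorem eq_of_le_of_le_of_sup_eq_top {α : Type*} [Lattice α] [BoundedOrder α]
    [IsModularLattice α] {a b a' b' : α} (ha : a' ≤ a) (hb : b' ≤ b) (h : a' ⊔ b' = ⊤)
    (hd : Disjoint a b) : a' = a ∧ b' = b := by
  constructor
  · refine eq_of_le_of_inf_le_of_sup_le (z := b) ha (by rw [hd.eq_bot]; exact bot_le) ?_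
    rw [eq_top_iff.2 (h.ge.trans (sup_le_sup_left hb a'))]
    exact le_top
  · refine eq_of_le_of_inf_le_of_sup_le (z := a) hb (by rw [hd.symm.eq_bot]; exact bot_le) ?_
    rw [sup_comm b' a, eq_top_iff.2 (h.ge.trans (sup_le_sup_right ha b'))]
    exact le_top

/-- In a group of exponent `2` a maximal subgroup has index `2`. -/
theorem IsCoatom.add_mem_of_notMem {G : Type*} [AddCommGroup G] (hG : ∀ g : G, g + g = 0)
    {H : AddSubgroup G} (hH : IsCoatom H) {x y : G} (hx : x ∉ H) (hy : y ∉ H) : x + y ∈ H := by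
  have h1 : H ⊔ AddSubgroup.zmultiples x = ⊤ := by
    refine hH.2 _ (lt_of_le_of_ne le_sup_left fun h => hx ?_)
    rw [h]
    exact AddSubgroup.mem_sup_right (AddSubgroup.mem_zmultiples x)
  have h2 : y ∈ H ⊔ AddSubgroup.zmultiples x := h1 ▸ AddSubgroup.mem_top y
  obtain ⟨h, hh, z, hz, rfl⟩ := AddSubgroup.mem_sup.1 h2
  obtain ⟨n, rfl⟩ := AddSubgroup.mem_zmultiples_iff.1 hz
  have h3 : ∀ m : ℤ, (m + m) • x = 0 := fun m => by rw [add_smul, ← smul_add, hG, smul_zero]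
  rcases Int.even_or_odd' n with ⟨k, rfl | rfl⟩
  · rw [two_mul, h3, add_zero] at hy
    exact absurd hh hy
  · rw [two_mul, add_smul, h3, one_smul, zero_add, add_left_comm, hG, add_zero]
    exact hh

theorem isCoatom_ker_of_ne_zero {G : Type*} [AddCommGroup G] {φ : G →+ ZMod 2} (hφ : φ ≠ 0) :
    IsCoatom φ.ker := by
  constructor
  · intro h
    refine hφ (AddMonoidHom.ext fun g => ?_)
    exact φ.mem_ker.1 (h ▸ AddSubgroup.mem_top g)
  · intro K hK
    obtain ⟨k, hk, hk'⟩ := SetLike.exists_of_lt hK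
    have hk1 : φ k = 1 := (ZMod.two_cases _).resolve_left fun h => hk' (φ.mem_ker.2 h)
    rw [eq_top_iff]
    intro g _
    rcases ZMod.two_cases (φ g) with h | h
    · exact hK.le (φ.mem_ker.2 h)
    · have : g - k ∈ φ.ker := by rw [φ.mem_ker, map_sub, h, hk1, sub_self]
      simpa using K.add_mem (hK.le this) hk

theorem TriIndex.add_self {p r : ℕ} {C : AddSubgroup (SpinorLabel p)} (g : TriIndex C r) :
    g + g = 0 :=
  Prod.ext (CharTwo.add_self_eq_zero g.1)
    (Prod.ext (neg_add_cancel g.2.1) (BitStr.add_self g.2.2))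

theorem lie_skewSpinor_ne_zero {p : ℕ} {v w : SpinorLabel p}
    (h : ¬Commute (spinor v) (spinor w)) : ⁅skewSpinor v, skewSpinor w⁆ ≠ 0 := by
  intro h0
  apply h
  rw [skewSpinor_eq, skewSpinor_eq, Ring.lie_def, sub_eq_zero] at h0
  simp only [Matrix.smul_mul, Matrix.mul_smul, smul_smul] at h0
  rw [mul_comm (spinorPhase w)] at h0
  exact smul_right_injective _
    (mul_ne_zero (spinorPhase_ne_zero v) (spinorPhase_ne_zero w)) h0

/-- A noncommuting pair of spinors whose commutator lies in a span of spinors has its bi-addition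
among the labels of this span. -/
theorem add_mem_of_lie_mem {p : ℕ} {v w : SpinorLabel p} {R : Set (SpinorLabel p)}
    (h : ¬Commute (spinor v) (spinor w)) (hR : ⁅skewSpinor v, skewSpinor w⁆ ∈ spinorSpan R) :
    v + w ∈ R := by
  by_contra hvw
  obtain ⟨c, hc⟩ := lie_skewSpinor_mem v w
  refine lie_skewSpinor_ne_zero h (Submodule.disjoint_def.1
    (disjoint_spinorSpan (Set.disjoint_singleton_left.2 hvw)) _ ?_ hR)
  rw [hc]
  exact Submodule.smul_mem _ _ (skewSpinor_mem_spinorSpan rfl)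

theorem isCartanDecomposition_of_partition {p r N : ℕ} (hN : N ≤ 2 ^ p)
    {U : Matrix.unitaryGroup (Fin N) ℂ} {t 𝔭 : Submodule ℝ (su N)}
    {C B : AddSubgroup (SpinorLabel p)} {W : TriIndex C r → Set (SpinorLabel p)}
    {H : AddSubgroup (TriIndex C r)} (hW : IsQuotientAlgebraPartitionOver U C B W)
    (hH : IsCoatom H) (ht : t = ⨆ g ∈ H, removed U (W g))
    (hp : 𝔭 = ⨆ g ∉ H, removed U (W g)) :
    IsSpinorGenerated p U t 𝔭 ∧ IsCartanDecomposition t 𝔭 := by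
  set T : Set (SpinorLabel p) := {v | ∃ g ∈ H, v ∈ W g}
  have hTc : ∀ v, v ∉ T ↔ ∃ g ∉ H, v ∈ W g := by
    intro v
    obtain ⟨g, hg, hg'⟩ := hW.partition v
    constructor
    · intro h
      exact ⟨g, fun hgH => h ⟨g, hgH, hg⟩, hg⟩
    · rintro ⟨g', hg'H, hvg'⟩ ⟨g'', hg''H, hvg''⟩
      exact hg'H (by rwa [hg' g' hvg', ← hg' g'' hvg''])
  have ht1 : t ≤ removed U T := by
    rw [ht]
    exact iSup₂_le fun g hg => removed_mono U fun v hv => ⟨g, hg, hv⟩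
  have hp1 : 𝔭 ≤ removed U Tᶜ := by
    rw [hp]
    exact iSup₂_le fun g hg => removed_mono U fun v hv => (hTc v).2 ⟨g, hg, hv⟩
  have htop : t ⊔ 𝔭 = ⊤ := by
    rw [ht, hp, ← iSup_split, hW.span]
  have hdisj : Disjoint (removed U T) (removed U Tᶜ) := disjoint_removed hN U disjoint_compl_right
  obtain ⟨ht2, hp2⟩ := eq_of_le_of_le_of_sup_eq_top ht1 hp1 htop hdisj
  have hcl : ∀ g h v w, v ∈ W g → w ∈ W h → ¬Commute (spinor v) (spinor w) →
      v + w ∈ W (g + h) := fun g h v w hv hw hvw => add_mem_of_lie_mem hvw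
    (hW.closure g h _ (skewSpinor_mem_spinorSpan hv) _ (skewSpinor_mem_spinorSpan hw))
  refine ⟨⟨T, ht2, hp2⟩, ⟨?_, ?_⟩, ?_, ?_, ?_, ?_⟩
  · rw [ht2, hp2]; exact hdisj
  · exact codisjoint_iff.2 htop
  · intro X hX Y hY
    rw [ht2, mem_removed] at hX hY ⊢
    rw [placeBlock_lie hN]
    refine lie_mem_spinorSpan ?_ hX hY
    rintro v ⟨g, hg, hv⟩ w ⟨h, hh, hw⟩ hvw
    exact ⟨g + h, H.add_mem hg hh, hcl g h v w hv hw hvw⟩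
  · intro X hX Y hY
    rw [ht2, mem_removed] at hX
    rw [hp2, mem_removed] at hY ⊢
    rw [placeBlock_lie hN]
    refine lie_mem_spinorSpan ?_ hX hY
    rintro v ⟨g, hg, hv⟩ w hw hvw
    obtain ⟨h, hh, hw⟩ := (hTc w).1 hw
    exact (hTc _).2 ⟨g + h, by rwa [H.add_mem_cancel_left hg], hcl g h v w hv hw hvw⟩
  · intro X hX Y hY
    rw [hp2, mem_removed] at hX hY
    rw [ht2, mem_removed, placeBlock_lie hN]
    refine lie_mem_spinorSpan ?_ hX hY
    intro v hv w hw hvw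
    obtain ⟨g, hg, hv⟩ := (hTc v).1 hv
    obtain ⟨h, hh, hw⟩ := (hTc w).1 hw
    exact ⟨g + h, hH.add_mem_of_notMem TriIndex.add_self hg hh, hcl g h v w hv hw hvw⟩
  · intro X hX Y hY
    rw [ht2, mem_removed] at hX
    rw [hp2, mem_removed] at hY
    rw [← trace_placeBlock_mul hN U]
    exact trace_mul_of_mem_spinorSpan disjoint_compl_right hX hY

/-! ### The quotient algebra partition by the diagonal spinors -/

/-- The Cartan subalgebra of the diagonal spinors `S^ζ_0`. -/
def diagonalCartan (p : ℕ) : AddSubgroup (SpinorLabel p) :=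
  (AddMonoidHom.snd (BitStr p) (BitStr p)).ker

theorem mem_diagonalCartan {p : ℕ} {v : SpinorLabel p} : v ∈ diagonalCartan p ↔ v.2 = 0 :=
  Iff.rfl

/-- The maximal bi-subalgebra of the diagonal spinors commuting with the spinors `S^ζ_α`. -/
def orthBisub {p : ℕ} (α : BitStr p) : MaxBisub (diagonalCartan p) :=
  ⟨{ carrier := {v | v.2 = 0 ∧ v.1 ⬝ᵥ α = 0}
     add_mem' := by
      rintro v w ⟨hv, hv'⟩ ⟨hw, hw'⟩
      exact ⟨by simp [hv, hw], by simp [add_dotProduct, hv', hw']⟩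
     zero_mem' := by simp
     neg_mem' := by
      intro v hv
      simpa only [SpinorLabel.neg_eq] using hv },
    fun v hv => hv.1, by
      intro v hv w hw hv' hw'
      have hv1 := (ZMod.two_cases (v.1 ⬝ᵥ α)).resolve_left fun h => hv' ⟨hv, h⟩
      have hw1 := (ZMod.two_cases (w.1 ⬝ᵥ α)).resolve_left fun h => hw' ⟨hw, h⟩
      refine ⟨(diagonalCartan p).add_mem hv hw, ?_⟩
      rw [Prod.fst_add, add_dotProduct, hv1, hw1]
      exact CharTwo.add_self_eq_zero _⟩

theorem mem_orthBisub {p : ℕ} {α : BitStr p} {v : SpinorLabel p} :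
    v ∈ (orthBisub α).1 ↔ v.2 = 0 ∧ v.1 ⬝ᵥ α = 0 := Iff.rfl

theorem orthBisub_zero (p : ℕ) : orthBisub (0 : BitStr p) = 0 :=
  MaxBisub.ext' fun v hv => by
    change _ ↔ v ∈ diagonalCartan p
    rw [mem_orthBisub, mem_diagonalCartan, dotProduct_zero]
    simp

theorem orthBisub_add {p : ℕ} (α β : BitStr p) :
    orthBisub (α + β) = orthBisub α + orthBisub β :=
  MaxBisub.ext' fun v hv => by
    change _ ↔ v ∈ diagonalCartan p ∧ (v ∈ (orthBisub α).1 ↔ v ∈ (orthBisub β).1)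
    have hv' := mem_diagonalCartan.1 hv
    simp only [mem_orthBisub, hv, hv', true_and, dotProduct_add]
    rcases ZMod.two_cases (v.1 ⬝ᵥ α) with h | h <;>
      rcases ZMod.two_cases (v.1 ⬝ᵥ β) with h' | h' <;> simp [h, h']; decide

theorem orthBisub_injective {p : ℕ} : Function.Injective (orthBisub (p := p)) := by
  -- As `α ↦ orthBisub α` is additive, it suffices to look at its kernel.
  have h0 : ∀ γ : BitStr p, orthBisub γ = 0 → γ = 0 := by
    intro γ h
    funext k
    have h2 : ((Pi.single k 1, 0) : SpinorLabel p) ∈ (orthBisub γ).1 := by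
      rw [h]
      exact mem_diagonalCartan.2 rfl
    simpa using (mem_orthBisub.1 h2).2
  intro α β h
  rw [← BitStr.add_eq_zero_iff]
  apply h0
  rw [orthBisub_add, h]
  exact neg_add_cancel (orthBisub β)

/-- The index of the member of the partition that contains a label; `d` lists the translations
whose characters `ζ ↦ ζ·d_j` distinguish the cosets of the `r`-th maximal bi-subalgebra. -/
def triLabel {p r : ℕ} (d : Fin r → BitStr p) (v : SpinorLabel p) :
    TriIndex (diagonalCartan p) r :=
  (1 + v.1 ⬝ᵥ v.2, orthBisub v.2, fun j => v.1 ⬝ᵥ d j)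

theorem triLabel_eq_iff {p r : ℕ} {d : Fin r → BitStr p} {v : SpinorLabel p} {ε : ZMod 2}
    {M : MaxBisub (diagonalCartan p)} {i : BitStr r} :
    triLabel d v = (ε, M, i) ↔
      1 + v.1 ⬝ᵥ v.2 = ε ∧ orthBisub v.2 = M ∧ ∀ j, v.1 ⬝ᵥ d j = i j := by
  simp [triLabel, Prod.ext_iff, funext_iff]

/-- The index is additive on noncommuting pairs of labels, although its parity component is a
quadratic function of the label. -/
theorem triLabel_add {p r : ℕ} (d : Fin r → BitStr p) {v w : SpinorLabel p}
    (h : ¬Commute (spinor v) (spinor w)) :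
    triLabel d (v + w) = triLabel d v + triLabel d w := by
  rw [commute_spinor_iff] at h
  refine Prod.ext ?_ (Prod.ext (orthBisub_add _ _) ?_)
  · simp only [triLabel, Prod.fst_add, Prod.snd_add, add_dotProduct, dotProduct_add]
    generalize v.1 ⬝ᵥ w.2 = a at *
    generalize w.1 ⬝ᵥ v.2 = b at *
    generalize v.1 ⬝ᵥ v.2 = c at *
    generalize w.1 ⬝ᵥ w.2 = e at *
    revert a b c e
    decide
  · funext j
    simp [triLabel, add_dotProduct]

theorem isCartanBisubalgebra_diagonalCartan (p : ℕ) :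
    IsCartanBisubalgebra (diagonalCartan p) := by
  intro v
  simp only [commute_spinor_iff, mem_diagonalCartan]
  constructor
  · intro hv w hw
    rw [hv, hw, dotProduct_zero, dotProduct_zero]
  · intro h
    funext k
    simpa [eq_comm] using h (Pi.single k 1, 0) rfl

theorem isQuotientAlgebraPartition_triLabel {p r : ℕ} {d : Fin r → BitStr p}
    {B : AddSubgroup (SpinorLabel p)} (hB : IsRthMaximal (diagonalCartan p) r B)
    (hBd : ∀ v, v ∈ B ↔ v.2 = 0 ∧ ∀ j, v.1 ⬝ᵥ d j = 0)
    (hd : ∀ i : BitStr r, ∃ ζ : BitStr p, ∀ j, ζ ⬝ᵥ d j = i j) :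
    IsQuotientAlgebraPartition (diagonalCartan p) B (fun g => triLabel d ⁻¹' {g}) where
  isCartan := isCartanBisubalgebra_diagonalCartan p
  isRthMaximal := hB
  partition v := ⟨triLabel d v, rfl, fun g hg => hg.symm⟩
  degrade_one_zero := by
    ext v
    rw [Set.mem_preimage, Set.mem_singleton_iff, triLabel_eq_iff, SetLike.mem_coe, hBd,
      ← orthBisub_zero, orthBisub_injective.eq_iff]
    constructor
    · rintro ⟨-, h, h'⟩
      exact ⟨h, h'⟩
    · rintro ⟨h, h'⟩
      exact ⟨by rw [h, dotProduct_zero, add_zero], h, h'⟩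
  degrade_one i := by
    obtain ⟨ζ, hζ⟩ := hd i
    refine ⟨(ζ, 0), mem_diagonalCartan.2 rfl, ?_⟩
    ext v
    rw [Set.mem_preimage, Set.mem_singleton_iff, triLabel_eq_iff, Set.mem_ofPred_eq, hBd,
      ← orthBisub_zero, orthBisub_injective.eq_iff]
    simp only [Prod.fst_add, Prod.snd_add, add_zero, add_dotProduct, hζ, CharTwo.add_eq_zero]
    constructor
    · rintro ⟨-, h, h'⟩
      exact ⟨h, h'⟩
    · rintro ⟨h, h'⟩
      exact ⟨by rw [h, dotProduct_zero, add_zero], h, h'⟩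
  degrade_zero i := by
    ext v
    rw [Set.mem_preimage, Set.mem_singleton_iff, triLabel_eq_iff,
      ← orthBisub_zero, orthBisub_injective.eq_iff]
    simp only [Set.mem_empty_iff_false, iff_false]
    rintro ⟨h, h', -⟩
    simp [h'] at h
  commutator_rule ε M i v hv w hw := by
    obtain ⟨-, rfl, -⟩ := triLabel_eq_iff.1 hv
    obtain ⟨h1, h2⟩ := mem_orthBisub.1 hw
    rw [commute_spinor_iff, h1, h2, dotProduct_zero]
  coset_rule ε σ M i j v hv w hw := by
    obtain ⟨-, rfl, hv3⟩ := triLabel_eq_iff.1 hv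
    obtain ⟨-, hw2, hw3⟩ := triLabel_eq_iff.1 hw
    have h : v.2 + w.2 = 0 := by
      rw [orthBisub_injective hw2, BitStr.add_self]
    refine triLabel_eq_iff.2 ⟨?_, ?_, fun k => ?_⟩
    · rw [Prod.snd_add, h, dotProduct_zero, add_zero]
    · rw [Prod.snd_add, h, orthBisub_zero]
    · rw [Prod.fst_add, add_dotProduct, hv3, hw3, Pi.add_apply]
  bisection_rule ε σ M i j v hv w hw := by
    obtain ⟨rfl, rfl, -⟩ := triLabel_eq_iff.1 hv
    obtain ⟨rfl, hw2, -⟩ := triLabel_eq_iff.1 hw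
    have h := orthBisub_injective hw2
    rw [mem_orthBisub, Prod.snd_add, Prod.fst_add, h, BitStr.add_self, add_dotProduct,
      CharTwo.add_eq_zero]
    simp
  closure := by
    intro g h X hX Y hY
    refine lie_mem_spinorSpan ?_ hX hY
    rintro v rfl w rfl hvw
    exact triLabel_add d hvw

/-! ### Multipliers that preserve the block of `su(N)` -/

/-- `Y` belongs to the image of `su(N)`. -/
def IsSuBlock (p N : ℕ) (Y : Matrix (BitStr p) (BitStr p) ℂ) : Prop :=
  Yᴴ = -Y ∧ Y.trace = 0 ∧ IsBlock p N Y

/-- The multiplier with symbol `f` preserves `su(N)`. -/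
def PreservesBlock {p : ℕ} (N : ℕ) (f : SpinorLabel p → ℂ) : Prop :=
  ∀ Y, IsSuBlock p N Y → IsSuBlock p N (multiplier f Y)

theorem PreservesBlock.mul {p N : ℕ} {f g : SpinorLabel p → ℂ} (hf : PreservesBlock N f)
    (hg : PreservesBlock N g) : PreservesBlock N (f * g) := by
  intro Y hY
  rw [multiplier_mul]
  exact hf _ (hg Y hY)

theorem PreservesBlock.add {p N : ℕ} {f g : SpinorLabel p → ℂ} (hf : PreservesBlock N f)
    (hg : PreservesBlock N g) : PreservesBlock N (f + g) := by
  intro Y hY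
  rw [multiplier_add]
  obtain ⟨h1, h2, h3⟩ := hf Y hY
  obtain ⟨h1', h2', h3'⟩ := hg Y hY
  refine ⟨?_, ?_, fun z w h => ?_⟩
  · rw [Matrix.conjTranspose_add, h1, h1']; abel
  · rw [Matrix.trace_add, h2, h2', add_zero]
  · by_cases h4 : multiplier f Y z w = 0
    · exact h3' z w fun h5 => h (by rw [Matrix.add_apply, h4, h5, add_zero])
    · exact h3 z w h4

theorem preservesBlock_const {p N : ℕ} (c : ℝ) :
    PreservesBlock N (fun _ : SpinorLabel p => (c : ℂ)) := by
  intro Y hY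
  rw [multiplier_const]
  refine ⟨?_, ?_, fun z w h => ?_⟩
  · rw [Matrix.conjTranspose_smul, hY.1]; simp
  · rw [Matrix.trace_smul, hY.2.1, smul_zero]
  · exact hY.2.2 z w fun h5 => h (by rw [Matrix.smul_apply, h5, smul_zero])

theorem preservesBlock_transpose (p N : ℕ) :
    PreservesBlock N (fun v : SpinorLabel p => bitSign (v.1 ⬝ᵥ v.2)) := by
  intro Y hY
  rw [multiplier_transpose]
  refine ⟨?_, ?_, fun z w h => (hY.2.2 w z h).symm⟩
  · exact congrArg Matrix.transpose hY.1
  · rw [Matrix.trace_transpose, hY.2.1]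

theorem preservesBlock_translate {p N : ℕ} {d : BitStr p}
    (hd : ∀ x ∈ blockSet p N, x + d ∈ blockSet p N) :
    PreservesBlock N (fun v : SpinorLabel p => bitSign (v.1 ⬝ᵥ d)) := by
  have hd' : ∀ x, x + d ∈ blockSet p N → x ∈ blockSet p N := fun x hx => by
    have := hd _ hx
    rwa [add_assoc, BitStr.add_self, add_zero] at this
  intro Y hY
  rw [multiplier_translate]
  refine ⟨?_, ?_, fun z w h => ?_⟩
  · rw [Matrix.conjTranspose_submatrix, hY.1]; rfl
  · rw [← hY.2.1]
    exact Equiv.sum_comp (Equiv.addRight d) fun x => Y x x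
  · exact (hY.2.2 _ _ h).imp (hd' z) (hd' w)

open Classical in
theorem preservesBlock_diagonal {p N : ℕ} (α : BitStr p) :
    PreservesBlock N (fun v : SpinorLabel p => if v.2 = α then 1 else 0) := by
  intro Y hY
  rw [multiplier_diagonal]
  refine ⟨?_, ?_, fun z w h => hY.2.2 z w fun h5 => h (by simp [h5])⟩
  · ext z w
    have h1 := congrFun (congrFun hY.1 z) w
    simp only [Matrix.conjTranspose_apply, Matrix.neg_apply, Matrix.of_apply] at h1 ⊢
    rw [add_comm w z]
    split_ifs
    · exact h1
    · simp
  · by_cases hα : 0 = α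
    · rw [← hY.2.1]
      simp [Matrix.trace, BitStr.add_self, hα]
    · simp [Matrix.trace, BitStr.add_self, hα]

theorem PreservesBlock.level {p N : ℕ} {q : SpinorLabel p → ZMod 2}
    (hq : PreservesBlock N fun v => bitSign (q v)) (b : ZMod 2) :
    PreservesBlock N fun v => if q v = b then 1 else 0 := by
  have h : (fun v => if q v = b then (1 : ℂ) else 0) =
      (fun _ => ((2⁻¹ : ℝ) : ℂ)) + (fun _ => ((2⁻¹ * (-1) ^ b.val : ℝ) : ℂ)) *
        fun v => bitSign (q v) := by
    funext v
    simp only [Pi.add_apply, Pi.mul_apply]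
    generalize q v = a
    rcases ZMod.two_cases a with rfl | rfl <;> rcases ZMod.two_cases b with rfl | rfl <;>
      norm_num [ZMod.val_one]
  rw [h]
  exact (preservesBlock_const _).add ((preservesBlock_const _).mul hq)

theorem PreservesBlock.prod {p N : ℕ} {ι : Type*} (s : Finset ι) {f : ι → SpinorLabel p → ℂ}
    (hf : ∀ i ∈ s, PreservesBlock N (f i)) : PreservesBlock N (∏ i ∈ s, f i) := by
  classical
  induction s using Finset.induction_on with
  | empty =>
    have h := preservesBlock_const (p := p) (N := N) 1
    rw [Complex.ofReal_one] at h
    exact h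
  | insert i s hi ih =>
    rw [Finset.prod_insert hi]
    exact (hf i (Finset.mem_insert_self i s)).mul
      (ih fun j hj => hf j (Finset.mem_insert_of_mem hj))

/-- The projections onto the members of the partition preserve `su(N)`: they are polynomials in the
transposition, the translations by `d_j`, and the restrictions to the entries `(x, x + α)`. -/
theorem preservesBlock_labelIndicator_triLabel {p r N : ℕ} {d : Fin r → BitStr p}
    (hd : ∀ j, ∀ x ∈ blockSet p N, x + d j ∈ blockSet p N) (g : TriIndex (diagonalCartan p) r) :
    PreservesBlock N (labelIndicator (triLabel d ⁻¹' {g})) := by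
  classical
  obtain ⟨ε, M, i⟩ := g
  by_cases hM : ∃ α, orthBisub α = M
  · obtain ⟨α, rfl⟩ := hM
    have h : labelIndicator (triLabel d ⁻¹' {(ε, orthBisub α, i)}) =
        (fun v => if v.1 ⬝ᵥ v.2 = 1 + ε then 1 else 0) * (fun v => if v.2 = α then 1 else 0) *
          ∏ j, fun v => if v.1 ⬝ᵥ d j = i j then 1 else 0 := by
      funext v
      have h1 : 1 + v.1 ⬝ᵥ v.2 = ε ↔ v.1 ⬝ᵥ v.2 = 1 + ε := by
        generalize v.1 ⬝ᵥ v.2 = a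
        revert a ε
        decide
      simp only [labelIndicator, Set.indicator_apply, Set.mem_preimage, Set.mem_singleton_iff,
        triLabel_eq_iff, orthBisub_injective.eq_iff, h1, Pi.one_apply, Pi.mul_apply,
        Finset.prod_apply, Finset.prod_boole]
      split_ifs <;> simp_all
    rw [h]
    refine (((preservesBlock_transpose p N).level _).mul (preservesBlock_diagonal α)).mul ?_
    exact PreservesBlock.prod _ fun j _ => (preservesBlock_translate (hd j)).level _
  · have h : labelIndicator (triLabel d ⁻¹' {(ε, M, i)}) = fun _ => ((0 : ℝ) : ℂ) := by
      funext v
      have : ¬triLabel d v = (ε, M, i) := fun h => hM ⟨_, (triLabel_eq_iff.1 h).2.1⟩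
      simp [labelIndicator, this]
    rw [h]
    exact preservesBlock_const 0

theorem iSup_removed_eq_top {p N : ℕ} (hN : N ≤ 2 ^ p) (U : Matrix.unitaryGroup (Fin N) ℂ)
    {ι : Type*} {l : SpinorLabel p → ι}
    (h : ∀ g, PreservesBlock N (labelIndicator (l ⁻¹' {g}))) :
    ⨆ g, removed U (l ⁻¹' {g}) = ⊤ := by
  classical
  rw [eq_top_iff]
  intro X _
  have hX := (mem_range_placeBlock_iff hN U).1 ⟨X, rfl⟩
  choose Z hZ using fun g => (mem_range_placeBlock_iff hN U).2 (h g _ hX)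
  have hsum : ∑ g ∈ Finset.univ.image l, labelIndicator (l ⁻¹' {g}) = fun _ => (1 : ℂ) := by
    funext v
    rw [Finset.sum_apply, Finset.sum_eq_single (l v)]
    · simp [labelIndicator]
    · intro g _ hg
      simp [labelIndicator, hg.symm]
    · simp
  have hXZ : X = ∑ g ∈ Finset.univ.image l, Z g := by
    apply placeBlock_injective hN U
    rw [map_sum]
    simp only [hZ]
    rw [← multiplier_sum, hsum, multiplier_const, one_smul]
  rw [hXZ]
  refine Submodule.sum_mem _ fun g _ => Submodule.mem_iSup_of_mem g ?_
  rw [mem_removed, hZ]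
  exact multiplier_labelIndicator_mem _ hX.1

/-- The character of `𝒢(C)` given by an element `c` of `C`: it is trivial on the maximal
bi-subalgebras that contain `c`. -/
def evalCharacter {p : ℕ} {C : AddSubgroup (SpinorLabel p)} {c : SpinorLabel p} (hc : c ∈ C) :
    MaxBisub C →+ ZMod 2 := by
  classical
  exact
  { toFun := fun M => if c ∈ M.1 then 0 else 1
    map_zero' := if_pos hc
    map_add' := fun M M' => by
      have h : c ∈ (M + M').1 ↔ (c ∈ M.1 ↔ c ∈ M'.1) := and_iff_right hc
      simp only [h]
      by_cases h1 : c ∈ M.1 <;> by_cases h2 : c ∈ M'.1 <;> simp [h1, h2]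
      decide }

theorem evalCharacter_orthBisub {p : ℕ} (ζ α : BitStr p) :
    evalCharacter (mem_diagonalCartan.2 rfl : ((ζ, 0) : SpinorLabel p) ∈ diagonalCartan p)
      (orthBisub α) = ζ ⬝ᵥ α := by
  classical
  change (if _ then _ else _) = _
  simp only [mem_orthBisub, true_and]
  split_ifs with h
  · exact h.symm
  · exact ((ZMod.two_cases _).resolve_left h).symm

/-- If, away from the label `0`, the set `T` is the zero set of a form that is a character of the
tri-addition, then the decomposition by `T` arises from the partition by the diagonal spinors. -/
theorem exists_partition_of_character {p r N : ℕ} (hN : N ≤ 2 ^ p)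
    {U : Matrix.unitaryGroup (Fin N) ℂ} {t 𝔭 : Submodule ℝ (su N)} (h𝔭 : 𝔭 ≠ ⊥)
    {d : Fin r → BitStr p} {B : AddSubgroup (SpinorLabel p)}
    (hB : IsRthMaximal (diagonalCartan p) r B)
    (hBd : ∀ v, v ∈ B ↔ v.2 = 0 ∧ ∀ j, v.1 ⬝ᵥ d j = 0)
    (hd : ∀ i : BitStr r, ∃ ζ : BitStr p, ∀ j, ζ ⬝ᵥ d j = i j)
    (hdN : ∀ j, ∀ x ∈ blockSet p N, x + d j ∈ blockSet p N)
    {T : Set (SpinorLabel p)} (ht : t = removed U T) (hp : 𝔭 = removed U Tᶜ)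
    {a : ZMod 2} {ζ₀ : BitStr p}
    (hT : ∀ v ≠ 0, v ∈ T ↔ a * (1 + v.1 ⬝ᵥ v.2) + ζ₀ ⬝ᵥ v.2 + ∑ j, v.1 ⬝ᵥ d j = 0) :
    ∃ (r : ℕ) (C B : AddSubgroup (SpinorLabel p)) (W : TriIndex C r → Set (SpinorLabel p))
      (H : AddSubgroup (TriIndex C r)),
      IsQuotientAlgebraPartitionOver U C B W ∧ IsCoatom H ∧
        t = ⨆ g ∈ H, removed U (W g) ∧ 𝔭 = ⨆ g ∉ H, removed U (W g) := by
  have hspan := iSup_removed_eq_top hN U (preservesBlock_labelIndicator_triLabel hdN)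
  have c₀ : ((ζ₀, 0) : SpinorLabel p) ∈ diagonalCartan p := mem_diagonalCartan.2 rfl
  let φ : TriIndex (diagonalCartan p) r →+ ZMod 2 :=
    (AddMonoidHom.mulLeft a).coprod ((evalCharacter c₀).coprod
      (∑ j, Pi.evalAddMonoidHom (fun _ : Fin r => ZMod 2) j))
  have hφ : ∀ v, φ (triLabel d v) =
      a * (1 + v.1 ⬝ᵥ v.2) + ζ₀ ⬝ᵥ v.2 + ∑ j, v.1 ⬝ᵥ d j := by
    intro v
    simp only [φ, triLabel, AddMonoidHom.coprod_apply, AddMonoidHom.coe_mulLeft,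
      evalCharacter_orthBisub, AddMonoidHom.finsetSum_apply, Pi.evalAddMonoidHom_apply, add_assoc]
  have hTφ : ∀ v ≠ 0, v ∈ T ↔ φ (triLabel d v) = 0 := fun v hv => by rw [hT v hv, hφ]
  have hle1 : ⨆ g ∈ φ.ker, removed U (triLabel d ⁻¹' {g}) ≤ removed U T := by
    refine iSup₂_le fun g hg => removed_le_of_ne_zero hN U ?_
    rintro v rfl hv
    exact (hTφ v hv).2 (φ.mem_ker.1 hg)
  have hle2 : ⨆ g ∉ φ.ker, removed U (triLabel d ⁻¹' {g}) ≤ removed U Tᶜ := by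
    refine iSup₂_le fun g hg => removed_le_of_ne_zero hN U ?_
    rintro v rfl hv hvT
    exact hg (φ.mem_ker.2 ((hTφ v hv).1 hvT))
  have hφ0 : φ ≠ 0 := by
    intro h0
    apply h𝔭
    rw [hp, eq_bot_iff, ← removed_empty hN U]
    refine removed_le_of_ne_zero hN U fun v hv hv0 => hv ((hTφ v hv0).2 ?_)
    rw [h0, AddMonoidHom.zero_apply]
  obtain ⟨h1, h2⟩ := eq_of_le_of_le_of_sup_eq_top hle1 hle2
    (by rw [← iSup_split, hspan]) (disjoint_removed hN U disjoint_compl_right)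
  refine ⟨r, diagonalCartan p, B, fun g => triLabel d ⁻¹' {g}, φ.ker,
    ⟨isQuotientAlgebraPartition_triLabel hB hBd hd, ?_, hspan⟩, isCoatom_ker_of_ne_zero hφ0,
    ht.trans h1.symm, hp.trans h2.symm⟩
  refine iSupIndep_removed hN U fun g g' hgg' => ?_
  refine Set.disjoint_left.2 ?_
  rintro v rfl h
  exact hgg' h

/-- The previous result for a form containing a single character `ζ ↦ ζ·d`: the rank is `0` if
`d = 0`, and `1` otherwise. -/
theorem exists_partition_of_form {p N : ℕ} (hN : N ≤ 2 ^ p)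
    {U : Matrix.unitaryGroup (Fin N) ℂ} {t 𝔭 : Submodule ℝ (su N)} (h𝔭 : 𝔭 ≠ ⊥)
    {d : BitStr p} (hdN : ∀ x ∈ blockSet p N, x + d ∈ blockSet p N)
    {T : Set (SpinorLabel p)} (ht : t = removed U T) (hp : 𝔭 = removed U Tᶜ)
    {a : ZMod 2} {ζ₀ : BitStr p}
    (hT : ∀ v ≠ 0, v ∈ T ↔ a * (1 + v.1 ⬝ᵥ v.2) + ζ₀ ⬝ᵥ v.2 + v.1 ⬝ᵥ d = 0) :
    ∃ (r : ℕ) (C B : AddSubgroup (SpinorLabel p)) (W : TriIndex C r → Set (SpinorLabel p))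
      (H : AddSubgroup (TriIndex C r)),
      IsQuotientAlgebraPartitionOver U C B W ∧ IsCoatom H ∧
        t = ⨆ g ∈ H, removed U (W g) ∧ 𝔭 = ⨆ g ∉ H, removed U (W g) := by
  by_cases hd : d = 0
  · refine exists_partition_of_character hN h𝔭 (d := (Fin.elim0 : Fin 0 → BitStr p))
      IsRthMaximal.zero ?_ ?_ ?_ ht hp (a := a) (ζ₀ := ζ₀) ?_
    · simp [mem_diagonalCartan]
    · simp
    · simp
    · simpa [hd] using hT
  · obtain ⟨k, hk⟩ := Function.ne_iff.1 hd
    have hk1 : d k = 1 := (ZMod.two_cases _).resolve_left hk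
    refine exists_partition_of_character hN h𝔭 (d := fun _ : Fin 1 => d)
      (B := (orthBisub d).1) (.succ .zero (orthBisub d).2 ?_) ?_ ?_ ?_ ht hp (a := a) (ζ₀ := ζ₀) ?_
    · intro h
      exact hd (orthBisub_injective (Subtype.ext (h.trans
        (congrArg Subtype.val (orthBisub_zero p)).symm)))
    · simp [mem_orthBisub]
    · intro i
      refine ⟨i 0 • Pi.single k 1, fun j => ?_⟩
      rw [smul_dotProduct, single_dotProduct, hk1, Subsingleton.elim j 0]
      simp
    · exact fun _ => hdN
    · simpa using hT

/-! ### Diagonal automorphisms of the block -/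

/-- `Y` is traceless and supported on the upper left block, i.e. it belongs to the image of the
complexification `sl(N)` of `su(N)`. -/
def IsSlBlock (p N : ℕ) (Y : Matrix (BitStr p) (BitStr p) ℂ) : Prop :=
  Y.trace = 0 ∧ IsBlock p N Y

/-- The multiplier with symbol `f` restricts to an endomorphism of the Lie algebra `sl(N)`; if `f` has no
zeros, this is an automorphism. -/
structure IsBlockAutomorphism {p : ℕ} (N : ℕ) (f : SpinorLabel p → ℂ) : Prop where
  map_block : ∀ Y, IsSlBlock p N Y → IsSlBlock p N (multiplier f Y)
  map_lie : ∀ X Y, IsSlBlock p N X → IsSlBlock p N Y →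
    multiplier f ⁅X, Y⁆ = ⁅multiplier f X, multiplier f Y⁆

theorem IsSlBlock.exists_skew_parts {p N : ℕ} {Y : Matrix (BitStr p) (BitStr p) ℂ}
    (hY : IsSlBlock p N Y) :
    ∃ A B, IsSuBlock p N A ∧ IsSuBlock p N B ∧ Y = A + Complex.I • B := by
  obtain ⟨htr, hb⟩ := hY
  have hb' : ∀ z w, ¬(z ∈ blockSet p N ∧ w ∈ blockSet p N) → Y z w = 0 ∧ Y w z = 0 :=
    fun z w h => ⟨not_not.1 fun h' => h (hb z w h'), not_not.1 fun h' => h (hb w z h').symm⟩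
  refine ⟨(2⁻¹ : ℂ) • (Y - Yᴴ), (-(Complex.I / 2) : ℂ) • (Y + Yᴴ),
    ⟨?_, ?_, fun z w h => ?_⟩, ⟨?_, ?_, fun z w h => ?_⟩, ?_⟩
  · simp [Matrix.conjTranspose_smul, ← smul_neg]
  · simp [htr, Matrix.trace_conjTranspose]
  · by_contra hzw
    obtain ⟨h1, h2⟩ := hb' z w hzw
    exact h (by simp [h1, h2])
  · rw [Matrix.conjTranspose_smul, Matrix.conjTranspose_add, Matrix.conjTranspose_conjTranspose,
      ← neg_smul, add_comm]
    simp [neg_div]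
  · simp [htr, Matrix.trace_conjTranspose]
  · by_contra hzw
    obtain ⟨h1, h2⟩ := hb' z w hzw
    exact h (by simp [h1, h2])
  · have h : Complex.I * -(Complex.I / 2) = 2⁻¹ := by
      linear_combination (-1 / 2 : ℂ) * Complex.I_mul_I
    rw [smul_smul, h, ← smul_add, sub_add_add_cancel, ← two_smul ℂ Y, smul_smul]
    norm_num

/-- The indicator in `Z_2` of the complement of `T`: the exponent of the sign of a label. -/
def labelSign {p : ℕ} (T : Set (SpinorLabel p)) (v : SpinorLabel p) : ZMod 2 := by
  classical
  exact if v ∈ T then 0 else 1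

theorem labelSign_eq_zero_iff {p : ℕ} {T : Set (SpinorLabel p)} {v : SpinorLabel p} :
    labelSign T v = 0 ↔ v ∈ T := by
  classical
  simp [labelSign]

/-- The multiplier that is `1` on `t` and `-1` on `𝔭` is an automorphism: it is the Cartan
involution. -/
theorem IsCartanDecomposition.isBlockAutomorphism {p N : ℕ} (hN : N ≤ 2 ^ p)
    {U : Matrix.unitaryGroup (Fin N) ℂ} {T : Set (SpinorLabel p)}
    (h : IsCartanDecomposition (removed U T) (removed U Tᶜ)) :
    IsBlockAutomorphism N fun v => bitSign (labelSign T v) := by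
  set D := multiplier fun v => bitSign (labelSign T v)
  have ht : ∀ a ∈ removed U T, D (placeBlock p U a) = placeBlock p U a := by
    intro a ha
    have := multiplier_eq_of_mem (f := fun v => bitSign (labelSign T v)) (c := 1)
      (fun v hv => by simp [labelSign_eq_zero_iff.2 hv]) ha
    simpa using this
  have hp : ∀ a ∈ removed U Tᶜ, D (placeBlock p U a) = -placeBlock p U a := by
    intro a ha
    have := multiplier_eq_of_mem (f := fun v => bitSign (labelSign T v)) (c := -1)
      (fun v hv => by
        rw [(ZMod.two_cases _).resolve_left (labelSign_eq_zero_iff.not.2 hv)]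
        simp) ha
    simpa using this
  have hsplit : ∀ X : su N, ∃ a ∈ removed U T, ∃ b ∈ removed U Tᶜ, a + b = X := fun X =>
    Submodule.mem_sup.1 (h.isCompl.sup_eq_top ▸ Submodule.mem_top)
  have hpres : ∀ Y, IsSuBlock p N Y → IsSuBlock p N (D Y) := by
    intro Y hY
    obtain ⟨X, rfl⟩ := (mem_range_placeBlock_iff hN U).2 hY
    obtain ⟨a, ha, b, hb, rfl⟩ := hsplit X
    refine (mem_range_placeBlock_iff hN U).1 ⟨a - b, ?_⟩
    rw [map_add, map_add, ht a ha, hp b hb, map_sub, sub_eq_add_neg]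
  have hlie : ∀ X Y, IsSuBlock p N X → IsSuBlock p N Y → D ⁅X, Y⁆ = ⁅D X, D Y⁆ := by
    intro X Y hX hY
    obtain ⟨X, rfl⟩ := (mem_range_placeBlock_iff hN U).2 hX
    obtain ⟨Y, rfl⟩ := (mem_range_placeBlock_iff hN U).2 hY
    obtain ⟨a, ha, b, hb, rfl⟩ := hsplit X
    obtain ⟨a', ha', b', hb', rfl⟩ := hsplit Y
    have h1 := ht _ (h.lie_t_t a ha a' ha')
    have h2 := hp _ (h.lie_t_p a ha b' hb')
    have h3 := hp _ (h.lie_t_p a' ha' b hb)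
    have h4 := ht _ (h.lie_p_p b hb b' hb')
    rw [placeBlock_lie hN] at h1 h2 h3 h4
    rw [← lie_skew, map_neg] at h3
    simp only [map_add, add_lie, lie_add, ht a ha, hp b hb, ht a' ha', hp b' hb', h1, h2, h4,
      neg_lie, lie_neg, neg_inj.1 h3]
    abel
  refine ⟨?_, ?_⟩
  · intro Y hY
    obtain ⟨A, B, hA, hB, rfl⟩ := hY.exists_skew_parts
    have hA' := hpres A hA
    have hB' := hpres B hB
    rw [map_add, map_smul]
    refine ⟨?_, fun z w hzw => ?_⟩
    · rw [Matrix.trace_add, Matrix.trace_smul, hA'.2.1, hB'.2.1, smul_zero, add_zero]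
    · by_cases h0 : D A z w = 0
      · exact hB'.2.2 z w fun h1 => hzw (by
          rw [Matrix.add_apply, Matrix.smul_apply, h0, h1, smul_zero, add_zero])
      · exact hA'.2.2 z w h0
  · intro X Y hX hY
    obtain ⟨A, B, hA, hB, rfl⟩ := hX.exists_skew_parts
    obtain ⟨A', B', hA', hB', rfl⟩ := hY.exists_skew_parts
    have hsl : ∀ (c : ℂ) (X Y : Matrix (BitStr p) (BitStr p) ℂ), ⁅c • X, Y⁆ = c • ⁅X, Y⁆ := by
      intro c X Y
      rw [Ring.lie_def, Ring.lie_def, Matrix.smul_mul, Matrix.mul_smul, smul_sub]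
    have hsr : ∀ (c : ℂ) (X Y : Matrix (BitStr p) (BitStr p) ℂ), ⁅X, c • Y⁆ = c • ⁅X, Y⁆ := by
      intro c X Y
      rw [Ring.lie_def, Ring.lie_def, Matrix.smul_mul, Matrix.mul_smul, smul_sub]
    change D _ = ⁅D _, D _⁆
    simp only [map_add, map_smul, add_lie, lie_add, hsl, hsr, hlie A A' hA hA',
      hlie A B' hA hB', hlie B A' hB hA', hlie B B' hB hB']

/-! ### The shape of the first `N` basis vectors -/

/-- More than half of the basis vectors belong to the block: those with leading digit `0` and at
least one with leading digit `1`. -/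
theorem exists_leading_eq_one {n N : ℕ} (hN : 2 ^ n < N) :
    ∃ e ∈ blockSet (n + 1) N, e 0 = 1 :=
  ⟨_, single_mem_blockSet hN, by simp⟩

theorem exists_ne_mem_blockSet {n N : ℕ} (hN : 2 ^ n < N) (x : BitStr (n + 1)) :
    ∃ y ∈ blockSet (n + 1) N, x ≠ y := by
  by_cases h : x = 0
  · obtain ⟨e, he, he1⟩ := exists_leading_eq_one hN
    refine ⟨e, he, ?_⟩
    rintro rfl
    rw [h] at he1
    exact zero_ne_one he1
  · exact ⟨0, mem_blockSet_of_leading_eq_zero hN rfl, h⟩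

theorem exists_pair_mem_blockSet {n N : ℕ} (hN : 2 ^ n < N) (α s : BitStr (n + 1)) :
    ∃ x ∈ blockSet (n + 1) N, x + α ∈ blockSet (n + 1) N ∧
      (x + s ∈ blockSet (n + 1) N ∨ x + s + α ∈ blockSet (n + 1) N) := by
  obtain ⟨e, he, he1⟩ := exists_leading_eq_one hN
  have hQ : ∀ x : BitStr (n + 1), x 0 = 0 → x ∈ blockSet (n + 1) N :=
    fun x => mem_blockSet_of_leading_eq_zero hN
  have h2 : (1 + 1 : ZMod 2) = 0 := by decide
  have h3 : ∀ x y : BitStr (n + 1), x + y + x = y := fun x y => by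
    linear_combination x * BitStr.two_eq_zero (n + 1)
  rcases ZMod.two_cases (α 0) with hα | hα <;> rcases ZMod.two_cases (s 0) with hs | hs
  · exact ⟨0, hQ _ rfl, hQ _ (by simp [hα]), .inl (hQ _ (by simp [hs]))⟩
  · exact ⟨s + e, hQ _ (by simp [hs, he1, h2]), hQ _ (by simp [hs, he1, h2, hα]),
      .inl (by rwa [h3])⟩
  · exact ⟨α + e, hQ _ (by simp [hα, he1, h2]), by rwa [h3],
      .inl (hQ _ (by simp [hs, he1, h2, hα]))⟩
  · exact ⟨e, he, hQ _ (by simp [hα, he1, h2]), .inl (hQ _ (by simp [hs, he1, h2]))⟩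

theorem exists_triple_mem_blockSet {n N : ℕ} (hN : 2 ^ n < N) (α β : BitStr (n + 1)) :
    ∃ y ∈ blockSet (n + 1) N, y + α ∈ blockSet (n + 1) N ∧ y + β ∈ blockSet (n + 1) N := by
  obtain ⟨e, he, he1⟩ := exists_leading_eq_one hN
  have hQ : ∀ x : BitStr (n + 1), x 0 = 0 → x ∈ blockSet (n + 1) N :=
    fun x => mem_blockSet_of_leading_eq_zero hN
  have h2 : (1 + 1 : ZMod 2) = 0 := by decide
  have h3 : ∀ x y : BitStr (n + 1), x + y + x = y := fun x y => by
    linear_combination x * BitStr.two_eq_zero (n + 1)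
  rcases ZMod.two_cases (α 0) with hα | hα <;> rcases ZMod.two_cases (β 0) with hβ | hβ
  · exact ⟨0, hQ _ rfl, hQ _ (by simp [hα]), hQ _ (by simp [hβ])⟩
  · exact ⟨β + e, hQ _ (by simp [hβ, he1, h2]), hQ _ (by simp [hα, hβ, he1, h2]), by rwa [h3]⟩
  · exact ⟨α + e, hQ _ (by simp [hα, he1, h2]), by rwa [h3], hQ _ (by simp [hα, hβ, he1, h2])⟩
  · exact ⟨e, he, hQ _ (by simp [hα, he1, h2]), hQ _ (by simp [hβ, he1, h2])⟩

/-! ### Classification of the diagonal automorphisms -/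

theorem multiplier_single {p : ℕ} (f : SpinorLabel p → ℂ) (x y z w : BitStr p) :
    multiplier f (Matrix.single x y 1) z w =
      if z + w = x + y then multiplierKernel f (x + y) (x + z) else 0 := by
  rw [multiplier_apply, Finset.sum_eq_single (x + z)]
  · have h1 : z + (x + z) = x := by linear_combination z * BitStr.two_eq_zero p
    have h2 : y = w + (x + z) ↔ z + w = x + y := by
      constructor <;> intro h
      · linear_combination -h - x * BitStr.two_eq_zero p
      · linear_combination -h - x * BitStr.two_eq_zero p
    rw [h1, Matrix.single_apply]
    by_cases h : z + w = x + y
    · rw [if_pos h, if_pos ⟨rfl, h2.2 h⟩, h, mul_one]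
    · rw [if_neg h, if_neg fun h' => h (h2.1 h'.2), mul_zero]
  · intro u _ hu
    rw [Matrix.single_apply, if_neg, mul_zero]
    rintro ⟨h, -⟩
    exact hu (by linear_combination -h - z * BitStr.two_eq_zero p)
  · simp

theorem multiplier_single_self {p : ℕ} (f : SpinorLabel p → ℂ) (a : BitStr p) :
    multiplier f (Matrix.single a a 1) =
      Matrix.diagonal fun z => multiplierKernel f 0 (a + z) := by
  ext z w
  rw [multiplier_single, BitStr.add_self, Matrix.diagonal_apply]
  simp only [BitStr.add_eq_zero_iff]

theorem lie_diagonal_apply {p : ℕ} (h : BitStr p → ℂ) (X : Matrix (BitStr p) (BitStr p) ℂ)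
    (z w : BitStr p) : ⁅Matrix.diagonal h, X⁆ z w = (h z - h w) * X z w := by
  rw [Ring.lie_def, Matrix.sub_apply, Matrix.diagonal_mul, Matrix.mul_diagonal]
  ring

theorem isSlBlock_single {p N : ℕ} {x y : BitStr p} (hx : x ∈ blockSet p N)
    (hy : y ∈ blockSet p N) (hxy : x ≠ y) : IsSlBlock p N (Matrix.single x y 1) := by
  refine ⟨Matrix.trace_single_eq_of_ne _ _ _ hxy, fun z w h => ?_⟩
  rw [Matrix.single_apply] at h
  obtain ⟨rfl, rfl⟩ := (ite_ne_right_iff.1 h).1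
  exact ⟨hx, hy⟩

theorem isSlBlock_single_sub_single {p N : ℕ} {a b : BitStr p} (ha : a ∈ blockSet p N)
    (hb : b ∈ blockSet p N) : IsSlBlock p N (Matrix.single a a 1 - Matrix.single b b 1) := by
  refine ⟨by simp, fun z w h => ?_⟩
  by_contra hzw
  apply h
  rw [Matrix.sub_apply, Matrix.single_apply, Matrix.single_apply, if_neg, if_neg, sub_zero]
  · rintro ⟨rfl, rfl⟩
    exact hzw ⟨hb, hb⟩
  · rintro ⟨rfl, rfl⟩
    exact hzw ⟨ha, ha⟩

variable {n N : ℕ} {f : SpinorLabel (n + 1) → ℂ}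

/-- The automorphism maps the root space of `E_{xy}` to the root space of every matrix unit that
occurs in the image of `E_{xy}`. Comparing the roots on the diagonal `H = E_{aa} - E_{bb}` relates
the kernels on the diagonal and off the diagonal. -/
theorem IsBlockAutomorphism.root_relation (hf : IsBlockAutomorphism N f)
    {x y a b d : BitStr (n + 1)} (hx : x ∈ blockSet (n + 1) N) (hy : y ∈ blockSet (n + 1) N)
    (hxy : x ≠ y) (ha : a ∈ blockSet (n + 1) N) (hb : b ∈ blockSet (n + 1) N)
    (hd : multiplierKernel f (x + y) d ≠ 0) :
    (multiplierKernel f 0 (a + (x + d)) - multiplierKernel f 0 (b + (x + d))) -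
        (multiplierKernel f 0 (a + (y + d)) - multiplierKernel f 0 (b + (y + d))) =
      ((if x = a then 1 else 0) - (if x = b then 1 else 0)) -
        ((if y = a then 1 else 0) - (if y = b then 1 else 0)) := by
  have h1 := hf.map_lie _ _ (isSlBlock_single_sub_single ha hb) (isSlBlock_single hx hy hxy)
  have h2 : (Matrix.single a a 1 - Matrix.single b b 1 : Matrix _ _ ℂ) =
      Matrix.diagonal fun z => (if z = a then 1 else 0) - (if z = b then 1 else 0) := by
    ext z w
    rw [Matrix.sub_apply, Matrix.single_apply, Matrix.single_apply, Matrix.diagonal_apply]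
    by_cases hzw : z = w
    · subst hzw
      simp [eq_comm]
    · have h3 : ∀ c : BitStr (n + 1), ¬(c = z ∧ c = w) := by
        rintro c ⟨rfl, rfl⟩
        exact hzw rfl
      simp [h3, hzw]
  have h3 : ⁅(Matrix.single a a 1 - Matrix.single b b 1 : Matrix _ _ ℂ), Matrix.single x y (1 : ℂ)⁆ =
      (((if x = a then 1 else 0) - (if x = b then 1 else 0)) -
        ((if y = a then 1 else 0) - (if y = b then 1 else 0)) : ℂ) •
          Matrix.single x y (1 : ℂ) := by
    rw [h2]
    ext z w
    rw [lie_diagonal_apply, Matrix.smul_apply, Matrix.single_apply]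
    by_cases h4 : x = z ∧ y = w
    · obtain ⟨rfl, rfl⟩ := h4
      rfl
    · simp [h4]
  rw [h3, map_smul, map_sub, multiplier_single_self, multiplier_single_self,
    Matrix.diagonal_sub] at h1
  have h4 := congrFun (congrFun h1 (x + d)) (y + d)
  have h5 : x + d + (y + d) = x + y := by linear_combination d * BitStr.two_eq_zero (n + 1)
  have h6 : x + (x + d) = d := by linear_combination x * BitStr.two_eq_zero (n + 1)
  rw [lie_diagonal_apply, Matrix.smul_apply, multiplier_single, if_pos h5, h6, smul_eq_mul] at h4
  exact (mul_right_cancel₀ hd h4).symm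

/-- As more than half of the basis vectors belong to the block, the root relation determines all
differences of the kernel on the diagonal. -/
theorem IsBlockAutomorphism.kernel_sub (hf : IsBlockAutomorphism N f) (hN : 2 ^ n < N)
    {α d : BitStr (n + 1)} (hα : α ≠ 0) (hd : multiplierKernel f α d ≠ 0) (s : BitStr (n + 1)) :
    multiplierKernel f 0 s - multiplierKernel f 0 (s + α) =
      (if s = d then 1 else 0) - (if s = d + α then 1 else 0) := by
  obtain ⟨x, hx, hy, hs⟩ := exists_pair_mem_blockSet hN α (s + d)
  have h2 := BitStr.two_eq_zero (n + 1)
  have hxy : x ≠ x + α := fun h => hα (by linear_combination -h)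
  have hd' : multiplierKernel f (x + (x + α)) d ≠ 0 := by
    rwa [show x + (x + α) = α by linear_combination x * h2]
  have e1 : x + (x + d) = d := by linear_combination x * h2
  have e2 : x + α + (x + d) = d + α := by linear_combination x * h2
  have e3 : x + (x + α + d) = d + α := by linear_combination x * h2
  have e4 : x + α + (x + α + d) = d := by linear_combination (x + α) * h2
  have h3 := hf.root_relation hx hy hxy hx hy hd'
  rw [e1, e2, e3, e4, if_pos rfl, if_neg hxy, if_neg hxy.symm, if_pos rfl] at h3
  have hda : multiplierKernel f 0 d - multiplierKernel f 0 (d + α) = 1 := by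
    linear_combination h3 / 2
  rcases hs with hs | hs
  · have h4 := hf.root_relation hx hy hxy hs hx hd'
    rw [e1, e3, if_pos rfl, if_neg hxy.symm,
      show x + (s + d) + (x + d) = s by linear_combination (x + d) * h2,
      show x + (s + d) + (x + α + d) = s + α by linear_combination (x + d) * h2] at h4
    have c1 : x = x + (s + d) ↔ s = d := by
      constructor <;> intro h
      · linear_combination -h - d * h2
      · linear_combination -h - d * h2
    have c2 : x + α = x + (s + d) ↔ s = d + α := by
      constructor <;> intro h
      · linear_combination -h - d * h2
      · linear_combination -h - d * h2
    simp only [c1, c2] at h4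
    linear_combination h4 + hda
  · have h4 := hf.root_relation hx hy hxy hs hx hd'
    rw [e1, e3, if_pos rfl, if_neg hxy.symm,
      show x + (s + d) + α + (x + d) = s + α by linear_combination (x + d) * h2,
      show x + (s + d) + α + (x + α + d) = s by linear_combination (x + d + α) * h2] at h4
    have c1 : x = x + (s + d) + α ↔ s = d + α := by
      constructor <;> intro h
      · linear_combination -h - (d + α) * h2
      · linear_combination -h - (d + α) * h2
    have c2 : x + α = x + (s + d) + α ↔ s = d := by
      constructor <;> intro h
      · linear_combination -h - d * h2
      · linear_combination -h - d * h2
    simp only [c1, c2] at h4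
    linear_combination -h4 - hda

/-- A function on `Z_2^p` whose differences `κ s - κ (s + α)` are those of a point mass at `d_α`, for
every `α ≠ 0`, is a constant plus or minus a point mass: either all the `d_α`, or all the
`d_α + α`, are equal. -/
theorem eq_or_eq_of_sub_eq {p : ℕ} {κ : BitStr p → ℂ} {R : BitStr p → BitStr p → Prop}
    (hex : ∀ α ≠ 0, ∃ d, R α d)
    (h : ∀ α ≠ 0, ∀ d, R α d → ∀ s,
      κ s - κ (s + α) = (if s = d then 1 else 0) - (if s = d + α then 1 else 0)) :
    (∃ d, ∀ α ≠ 0, ∀ d', R α d' → d' = d) ∨ ∃ d, ∀ α ≠ 0, ∀ d', R α d' → d' + α = d := by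
  have h2 := BitStr.two_eq_zero p
  by_contra hcon
  push Not at hcon
  obtain ⟨hcon1, hcon2⟩ := hcon
  obtain ⟨α₀, hα₀, d₀, hd₀, -⟩ := hcon1 0
  have hself : ∀ {α d : BitStr p}, α ≠ 0 → d ≠ d + α := fun hα h => hα (by linear_combination -h)
  have hR : ∀ {α d}, α ≠ 0 → R α d → κ d - κ (d + α) = 1 := by
    intro α d hα hd
    rw [h α hα d hd d, if_pos rfl, if_neg (hself hα), sub_zero]
  have hpair : ∀ s s', κ s - κ s' = 0 ∨ κ s - κ s' = 1 ∨ κ s - κ s' = -1 := by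
    intro s s'
    by_cases hs : s = s'
    · left; rw [hs, sub_self]
    · have hα : s + s' ≠ 0 := BitStr.add_eq_zero_iff.not.2 hs
      obtain ⟨d, hd⟩ := hex _ hα
      have h3 := h _ hα d hd s
      rw [show s + (s + s') = s' by linear_combination s * h2] at h3
      rw [h3]
      by_cases h4 : s = d
      · right; left
        rw [if_pos h4, if_neg (h4 ▸ hself hα), sub_zero]
      · rw [if_neg h4]
        split_ifs <;> simp
  -- The function takes only the values `m` and `m + 1`.
  obtain ⟨m, hm⟩ : ∃ m, m = κ (d₀ + α₀) := ⟨_, rfl⟩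
  have hd₀m : κ d₀ = m + 1 := by linear_combination hR hα₀ hd₀ - hm
  have hval : ∀ s, κ s = m ∨ κ s = m + 1 := by
    intro s
    have h3 := hpair s (d₀ + α₀)
    have h4 := hpair s d₀
    rw [← hm] at h3
    rw [hd₀m] at h4
    rcases h3 with h3 | h3 | h3
    · left; linear_combination h3
    · right; linear_combination h3
    · exfalso
      have h5 : κ s - (m + 1) = -2 := by linear_combination h3
      rw [h5] at h4
      norm_num at h4
  -- Each `α ≠ 0` translates exactly one point of value `m + 1` to a point of value `m`.
  have huniq : ∀ {α d}, α ≠ 0 → R α d → ∀ s, κ s = m + 1 → κ (s + α) = m → s = d := by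
    intro α d hα hd s hs hs'
    by_contra hsd
    have h3 := h α hα d hd s
    rw [hs, hs', if_neg hsd] at h3
    split_ifs at h3 <;> norm_num at h3
  have hmem : ∀ {α d}, α ≠ 0 → R α d → κ d = m + 1 ∧ κ (d + α) = m := by
    intro α d hα hd
    have h3 := hR hα hd
    rcases hval d with h4 | h4
    · exfalso
      rcases hval (d + α) with h5 | h5 <;> rw [h4, h5] at h3 <;> norm_num at h3
    · exact ⟨h4, by linear_combination h4 - h3⟩
  obtain ⟨α₁, hα₁, p₂, hp₂, hne⟩ := hcon1 d₀
  obtain ⟨α₂, hα₂, d₂, hd₂, hne'⟩ := hcon2 (d₀ + α₀)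
  have hp₂m := (hmem hα₁ hp₂).1
  have hq₂m := (hmem hα₂ hd₂).2
  have hkey : ∀ q, κ q = m → κ (d₀ + p₂ + q) = m + 1 := by
    intro q hq
    refine (hval _).resolve_left fun h3 => ?_
    have hα : d₀ + q ≠ 0 := BitStr.add_eq_zero_iff.not.2 fun h4 => by
      rw [h4, hq] at hd₀m
      norm_num at hd₀m
    obtain ⟨d, hd⟩ := hex _ hα
    have h5 := huniq hα hd d₀ hd₀m (by
      rwa [show d₀ + (d₀ + q) = q by linear_combination d₀ * h2])
    have h6 := huniq hα hd p₂ hp₂m (by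
      rwa [show p₂ + (d₀ + q) = d₀ + p₂ + q by ring])
    exact hne (h6.trans h5.symm)
  have hβ : d₀ + p₂ ≠ 0 := BitStr.add_eq_zero_iff.not.2 hne.symm
  obtain ⟨d, hd⟩ := hex _ hβ
  have h7 : ∀ q, κ q = m → d₀ + p₂ + q = d := fun q hq =>
    huniq hβ hd _ (hkey q hq) (by
      rwa [show d₀ + p₂ + q + (d₀ + p₂) = q by linear_combination (d₀ + p₂) * h2])
  exact hne' (add_left_cancel ((h7 _ hq₂m).trans (h7 _ hm.symm).symm))

/-- The automorphism maps `E_{xy}` to a multiple of `E_{x+d,y+d}` for all `x ≠ y`, or to a multiple of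
`E_{y+d,x+d}` for all `x ≠ y`: these cases are distinguished by the bit `a`. -/
theorem IsBlockAutomorphism.exists_kernel_support (hf : IsBlockAutomorphism N f)
    (hN : 2 ^ n < N) (hf0 : ∀ v, f v ≠ 0) :
    ∃ (a : ZMod 2) (d : BitStr (n + 1)),
      ∀ α ≠ 0, ∀ y, multiplierKernel f α y = if y = d + a • α then f (0, α) else 0 := by
  have h2 := BitStr.two_eq_zero (n + 1)
  have hex : ∀ α ≠ 0, ∃ d, multiplierKernel f α d ≠ 0 := by
    intro α _
    by_contra hcon
    push Not at hcon
    apply hf0 (0, α)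
    rw [← sum_multiplierKernel f 0 α]
    simp [hcon]
  have hsupp : ∃ (a : ZMod 2) (d : BitStr (n + 1)),
      ∀ α ≠ 0, ∀ y, multiplierKernel f α y ≠ 0 → y = d + a • α := by
    rcases eq_or_eq_of_sub_eq (R := fun α d => multiplierKernel f α d ≠ 0) hex
      (fun α hα d hd => hf.kernel_sub hN hα hd) with ⟨d, hd⟩ | ⟨d, hd⟩
    · exact ⟨0, d, fun α hα y hy => by rw [hd α hα y hy, zero_smul, add_zero]⟩
    · refine ⟨1, d, fun α hα y hy => ?_⟩
      rw [← hd α hα y hy, one_smul]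
      linear_combination -α * h2
  obtain ⟨a, d, had⟩ := hsupp
  refine ⟨a, d, fun α hα y => ?_⟩
  split_ifs with hy
  · rw [← sum_multiplierKernel f 0 α, Finset.sum_eq_single y]
    · simp
    · intro y' _ hy'
      rw [not_not.1 fun h => hy' ((had α hα y' h).trans hy.symm), zero_mul]
    · simp
  · exact not_not.1 fun h => hy (had α hα y h)

/-- The symbol of a diagonal automorphism of `sl(N)` is, up to its irrelevant value at the label
`0`, either a character (`a = 0`) or minus a character times the symbol `(-1)^(ζ·α)` of the
transposition (`a = 1`). -/
theorem IsBlockAutomorphism.exists_form {τ : SpinorLabel (n + 1) → ZMod 2}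
    (hf : IsBlockAutomorphism N fun v => bitSign (τ v)) (hN : 2 ^ n < N) :
    ∃ (a : ZMod 2) (ζ₀ d : BitStr (n + 1)),
      (∀ x ∈ blockSet (n + 1) N, x + d ∈ blockSet (n + 1) N) ∧
        ∀ v ≠ 0, τ v = a * (1 + v.1 ⬝ᵥ v.2) + ζ₀ ⬝ᵥ v.2 + v.1 ⬝ᵥ d := by
  have h2 := BitStr.two_eq_zero (n + 1)
  obtain ⟨a, d, hk⟩ := hf.exists_kernel_support hN fun v => bitSign_ne_zero _
  set f : SpinorLabel (n + 1) → ℂ := fun v => bitSign (τ v)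
  have hself : ∀ {α d : BitStr (n + 1)}, α ≠ 0 → d ≠ d + α :=
    fun hα h => hα (by linear_combination -h)
  -- The phase strings enter through the Fourier transform of a point mass.
  have hoff : ∀ ζ : BitStr (n + 1), ∀ α ≠ 0, τ (ζ, α) = τ (0, α) + (ζ ⬝ᵥ d + a * ζ ⬝ᵥ α) := by
    intro ζ α hα
    apply bitSign_injective
    change f (ζ, α) = _
    rw [← sum_multiplierKernel f ζ α, Finset.sum_eq_single (d + a • α)]
    · rw [hk α hα, if_pos rfl, dotProduct_add, dotProduct_smul, smul_eq_mul, bitSign_add (τ _)]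
    · intro y _ hy
      rw [hk α hα, if_neg hy, zero_mul]
    · simp
  have hdiag : ∀ ζ : BitStr (n + 1), ζ ≠ 0 → τ (ζ, 0) = a + ζ ⬝ᵥ d := by
    intro ζ hζ
    obtain ⟨m, h3⟩ : ∃ m, ∀ s, multiplierKernel f 0 s = m + if s = d then bitSign a else 0 := by
      refine ⟨multiplierKernel f 0 d - bitSign a, fun s => ?_⟩
      by_cases hs : s = d
      · rw [if_pos hs, hs]; ring
      · have hα : s + d ≠ 0 := BitStr.add_eq_zero_iff.not.2 hs
        have h4 : multiplierKernel f (s + d) (d + a • (s + d)) ≠ 0 := by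
          rw [hk _ hα, if_pos rfl]
          exact bitSign_ne_zero _
        have h5 := hf.kernel_sub hN hα h4 s
        rw [show s + (s + d) = d by linear_combination s * h2] at h5
        rw [if_neg hs]
        rcases ZMod.two_cases a with rfl | rfl
        · rw [zero_smul, add_zero, if_neg hs,
            if_pos (by linear_combination -d * h2)] at h5
          rw [bitSign_zero]
          linear_combination h5
        · rw [one_smul, if_pos (by linear_combination -d * h2),
            if_neg (fun h => hs (by linear_combination h + (s + d) * h2))] at h5
          rw [bitSign_one]
          linear_combination h5
    apply bitSign_injective
    change f (ζ, 0) = _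
    rw [← sum_multiplierKernel f ζ 0]
    simp only [h3, add_mul, Finset.sum_add_distrib, ← Finset.mul_sum, sum_bitSign_dotProduct,
      if_neg hζ, mul_zero, zero_add, ite_mul, zero_mul, Finset.sum_ite_eq', Finset.mem_univ,
      if_true, bitSign_add]
  have hstab : ∀ x ∈ blockSet (n + 1) N, x + d ∈ blockSet (n + 1) N := by
    intro x hx
    obtain ⟨y, hy, hxy⟩ := exists_ne_mem_blockSet hN x
    have hα : x + y ≠ 0 := BitStr.add_eq_zero_iff.not.2 hxy
    have h3 := (hf.map_block _ (isSlBlock_single hx hy hxy)).2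
      (x + (d + a • (x + y))) (y + (d + a • (x + y))) (by
        rw [multiplier_single, if_pos (by linear_combination (d + a • (x + y)) * h2), hk _ hα,
          if_pos (by linear_combination x * h2)]
        exact bitSign_ne_zero _)
    rcases ZMod.two_cases a with rfl | rfl
    · simpa using h3.1
    · have h4 := h3.2
      rwa [one_smul, show y + (d + (x + y)) = x + d by linear_combination y * h2] at h4
  -- The bracket `[E_{y+α,y}, E_{y,y+β}] = E_{y+α,y+β}` makes the factors multiplicative.
  have hmul : ∀ α β : BitStr (n + 1), α ≠ 0 → β ≠ 0 → α ≠ β →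
      τ (0, α + β) = a + τ (0, α) + τ (0, β) := by
    intro α β hα hβ hαβ
    obtain ⟨y, hy, hx, hz⟩ := exists_triple_mem_blockSet hN α β
    have hαβ' : α + β ≠ 0 := BitStr.add_eq_zero_iff.not.2 hαβ
    have hxz : y + α ≠ y + β := fun h => hαβ (add_left_cancel h)
    have h3 := hf.map_lie _ _ (isSlBlock_single hx hy (hself hα).symm)
      (isSlBlock_single hy hz (hself hβ))
    have h4 : ⁅(Matrix.single (y + α) y 1 : Matrix _ _ ℂ), Matrix.single y (y + β) (1 : ℂ)⁆ =
        Matrix.single (y + α) (y + β) (1 : ℂ) := by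
      rw [Ring.lie_def, Matrix.single_mul_single_same, mul_one,
        Matrix.single_mul_single_of_ne _ _ _ _ hxz.symm, sub_zero]
    have himg : ∀ x z : BitStr (n + 1), x ≠ z → multiplier f (Matrix.single x z 1) =
        f (0, x + z) • if a = 0 then Matrix.single (x + d) (z + d) 1
          else Matrix.single (z + d) (x + d) 1 := by
      intro x z hxz
      have hα : x + z ≠ 0 := BitStr.add_eq_zero_iff.not.2 hxz
      ext u w
      rw [multiplier_single, hk _ hα, Matrix.smul_apply, smul_eq_mul]
      rcases ZMod.two_cases a with rfl | rfl
      · rw [if_pos rfl, Matrix.single_apply, zero_smul, add_zero, ← ite_and, mul_ite, mul_one,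
          mul_zero]
        congr 1
        rw [eq_iff_iff]
        constructor
        · rintro ⟨h5, h6⟩
          exact ⟨by linear_combination -h6 + x * h2,
            by linear_combination h6 - h5 + (d - x) * h2⟩
        · rintro ⟨rfl, rfl⟩
          exact ⟨by linear_combination d * h2, by linear_combination x * h2⟩
      · rw [if_neg one_ne_zero, Matrix.single_apply, one_smul, ← ite_and, mul_ite, mul_one,
          mul_zero]
        congr 1
        rw [eq_iff_iff]
        constructor
        · rintro ⟨h5, h6⟩
          exact ⟨by linear_combination -h6, by linear_combination h6 - h5 + d * h2⟩
        · rintro ⟨rfl, rfl⟩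
          exact ⟨by linear_combination d * h2, by ring⟩
    rw [h4, himg _ _ hxz, himg _ _ (hself hα).symm, himg _ _ (hself hβ)] at h3
    rw [show y + α + (y + β) = α + β by linear_combination y * h2,
      show y + α + y = α by linear_combination y * h2,
      show y + (y + β) = β by linear_combination y * h2] at h3
    have hxz' : y + α + d ≠ y + β + d := fun h => hxz (add_right_cancel h)
    apply bitSign_injective
    rw [bitSign_add, bitSign_add]
    change f (0, α + β) = bitSign a * f (0, α) * f (0, β)
    rcases ZMod.two_cases a with rfl | rfl
    · simp only [if_true, Ring.lie_def, Matrix.smul_mul, Matrix.mul_smul,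
        Matrix.single_mul_single_same, Matrix.single_mul_single_of_ne _ _ _ _ hxz'.symm,
        smul_zero, sub_zero, mul_one, smul_smul] at h3
      have h5 := congrFun (congrFun h3 (y + α + d)) (y + β + d)
      simp only [Matrix.smul_apply, Matrix.single_apply_same, smul_eq_mul, mul_one] at h5
      rw [bitSign_zero, one_mul]
      linear_combination h5
    · simp only [if_neg one_ne_zero, Ring.lie_def, Matrix.smul_mul, Matrix.mul_smul,
        Matrix.single_mul_single_same, Matrix.single_mul_single_of_ne _ _ _ _ hxz',
        smul_zero, zero_sub, mul_one, smul_smul] at h3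
      have h5 := congrFun (congrFun h3 (y + β + d)) (y + α + d)
      simp only [Matrix.smul_apply, Matrix.neg_apply, Matrix.single_apply_same, smul_eq_mul,
        mul_one] at h5
      rw [bitSign_one]
      linear_combination h5
  -- Hence `α ↦ a + τ (0, α)` is linear away from `0`.
  have hmul' : ∀ α β : BitStr (n + 1), (if α + β = 0 then 0 else a + τ (0, α + β)) =
      (if α = 0 then 0 else a + τ (0, α)) + if β = 0 then 0 else a + τ (0, β) := by
    intro α β
    by_cases hα : α = 0
    · simp [hα]
    by_cases hβ : β = 0
    · simp [hβ]
    rw [if_neg hα, if_neg hβ]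
    by_cases hαβ : α = β
    · rw [if_pos (BitStr.add_eq_zero_iff.2 hαβ), hαβ, CharTwo.add_self_eq_zero]
    · rw [if_neg (BitStr.add_eq_zero_iff.not.2 hαβ), hmul α β hα hβ hαβ]
      ring
  let g : BitStr (n + 1) →+ ZMod 2 :=
    { toFun := fun α => if α = 0 then 0 else a + τ (0, α)
      map_zero' := if_pos rfl
      map_add' := hmul' }
  have hg : ∀ α ≠ 0, g α = a + τ (0, α) := fun α hα => if_neg hα
  let ζ₀ : BitStr (n + 1) := fun k => g (Pi.single k 1)
  have hζ₀ : ∀ α, g α = ζ₀ ⬝ᵥ α := by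
    intro α
    have h3 := LinearMap.pi_apply_eq_sum_univ (g.toZModLinearMap 2) α
    rw [AddMonoidHom.coe_toZModLinearMap] at h3
    rw [h3]
    refine Finset.sum_congr rfl fun k _ => ?_
    rw [smul_eq_mul, mul_comm]
    congr 2
    funext j
    simp [Pi.single_apply, eq_comm]
  refine ⟨a, ζ₀, d, hstab, ?_⟩
  rintro ⟨ζ, α⟩ hv
  by_cases hα : α = 0
  · subst hα
    have hζ : ζ ≠ 0 := by
      rintro rfl
      exact hv rfl
    rw [hdiag ζ hζ]
    simp
  · rw [hoff ζ α hα, ← hζ₀, hg α hα]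
    linear_combination -a * (by decide : (2 : ZMod 2) = 0)

end

/-! ### The equivalence -/

theorem mainTheorem1 (p N : ℕ) (hlow : 2 ^ p < 2 * N) (hup : N ≤ 2 ^ p)
    (U : Matrix.unitaryGroup (Fin N) ℂ) (t 𝔭 : Submodule ℝ (su N)) (h𝔭 : 𝔭 ≠ ⊥) :
    (IsSpinorGenerated p U t 𝔭 ∧ IsCartanDecomposition t 𝔭) ↔
      ∃ (r : ℕ) (C B : AddSubgroup (SpinorLabel p)) (W : TriIndex C r → Set (SpinorLabel p))
        (H : AddSubgroup (TriIndex C r)),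
        IsQuotientAlgebraPartitionOver U C B W ∧ IsCoatom H ∧
          t = ⨆ g ∈ H, removed U (W g) ∧ 𝔭 = ⨆ g ∉ H, removed U (W g) := by
  constructor
  · rintro ⟨⟨T, rfl, rfl⟩, hC⟩
    cases p with
    | zero =>
      -- Here `N = 1`, and `su(1) = 0` contradicts `𝔭 ≠ 0`.
      exfalso
      apply h𝔭
      have hN1 : N ≤ 1 := by simpa using hup
      rw [Submodule.eq_bot_iff]
      intro X _
      apply Subtype.ext
      ext i j
      have : Subsingleton (Fin N) := Fin.subsingleton_iff_le_one.2 hN1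
      have htr := X.2.2
      rw [Matrix.trace, Fintype.sum_subsingleton _ i, Matrix.diag_apply] at htr
      rw [Subsingleton.elim j i, htr]
      rfl
    | succ n =>
      have hN : 2 ^ n < N := by
        rw [pow_succ] at hlow
        omega
      obtain ⟨a, ζ₀, d, hd, hτ⟩ := (hC.isBlockAutomorphism hup).exists_form hN
      exact exists_partition_of_form hup h𝔭 hd rfl rfl fun v hv => by
        rw [← labelSign_eq_zero_iff, hτ v hv]
  · rintro ⟨r, C, B, W, H, hW, hH, ht, hp⟩
    exact isCartanDecomposition_of_partition hup hW hH ht hp
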